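/- Manifolds are smooth ($C^\infty$), finite-dimensional, of constant dimension, Hausdorff, second countable and without boundary. A simplicial manifold is a simplicial object in the category $\mathbf{Mfd}$ of such manifolds and smooth maps. For $n\ge 0$, an $n$-simplicial manifold is a contravariant functor to $\mathbf{Mfd}$ from the full subcategory $\Delta_{\le n}$ of the simplex category on $[0],\dots,[n]$. For $1\le m\le n$ and $0\le i\le m$, let $\Lambda^m_i\subseteq\Delta^m$ be the horn, that is, the union of the faces $\partial_j\Delta^m$ with $j\neq i$. An $n$-simplicial manifold $U_\bullet$ satisfies the Kan condition $\mathrm{Kan}(m,i)$ if the horn space $\Lambda^m_i(U)$, that is, the limit of $U_\bullet$ in $\mathbf{Mfd}$ weighted by $\Lambda^m_i$, exists in $\mathbf{Mfd}$, and the horn projection $U_m\to\Lambda^m_i(U)$ induced by the face maps $d_j$, $j\neq i$, is a (not necessarily surjective) submersion. **Theorem.** Let $X_\bullet$ be a simplicial manifold, and embed $X_0$ into each $X_m$ by the iterated degeneracy map. For every $n\ge 0$ there exist open neighbourhoods $U_m\subseteq X_m$ of $X_0$, $0\le m\le n$, such that all structure maps (faces and degeneracies) of $X_\bullet$ between the levels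 $0,\dots,n$ restrict to the $U_m$, and such that the resulting $n$-simplicial manifold $U_\bullet$ satisfies $\mathrm{Kan}(m,i)$ for all $1\le m\le n$ and $0\le i\le m$. -/

import Mathlib

open CategoryTheory Opposite Limits Simplicial
open scoped Manifold ContDiff

universe u

/-- A smooth (`C^∞`) manifold without boundary: a second countable Hausdorff space with a smooth
structure of (constant, finite) dimension `dim`. -/
structure Mfd : Type (u + 1) where
  carrier : Type u
  dim : ℕ
  [top : TopologicalSpace carrier]
  [t2 : T2Space carrier]
  [secondCountable : SecondCountableTopology carrier]
  [charted : ChartedSpace (EuclideanSpace ℝ (Fin dim)) carrier]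
  [smooth : IsManifold (𝓡 dim) ∞ carrier]

namespace Mfd

instance : CoeSort Mfd.{u} (Type u) := ⟨Mfd.carrier⟩

attribute [instance] Mfd.top Mfd.t2 Mfd.secondCountable Mfd.charted Mfd.smooth

/-- Smooth maps. -/
@[ext]
structure Hom (M N : Mfd.{u}) : Type u where
  toFun : M → N
  contMDiff : ContMDiff (𝓡 M.dim) (𝓡 N.dim) ∞ toFun

/-- The category of smooth manifolds and smooth maps. -/
instance : Category.{u} Mfd.{u} where
  Hom M N := Hom M N
  id M := ⟨id, contMDiff_id⟩
  comp f g := ⟨g.toFun ∘ f.toFun, g.contMDiff.comp f.contMDiff⟩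

@[simp]
theorem id_toFun (M : Mfd.{u}) : Hom.toFun (𝟙 M) = id := rfl

@[simp]
theorem comp_toFun {M N P : Mfd.{u}} (f : M ⟶ N) (g : N ⟶ P) :
    Hom.toFun (f ≫ g) = Hom.toFun g ∘ Hom.toFun f := rfl

/-- The class of submersions in the category of smooth manifolds (not necessarily surjective). -/
def submersions : MorphismProperty Mfd.{u} :=
  fun M N f => Manifold.IsSubmersion (𝓡 M.dim) (𝓡 N.dim) ∞ (Hom.toFun f)

/-- An open subset of a manifold, as an open submanifold. -/
noncomputable def ofOpens (M : Mfd.{u}) (U : TopologicalSpace.Opens M) : Mfd.{u} where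
  carrier := U
  dim := M.dim

theorem contMDiff_restrict {M N : Mfd.{u}} (f : M ⟶ N) (U : TopologicalSpace.Opens M)
    (V : TopologicalSpace.Opens N) (h : ∀ x ∈ U, Hom.toFun f x ∈ V) :
    ContMDiff (𝓡 M.dim) (𝓡 N.dim) ∞ (fun x : U => (⟨Hom.toFun f x.1, h x.1 x.2⟩ : V)) :=
  (ContMDiff.subtypeVal_comp_iff (I := 𝓡 M.dim) (I' := 𝓡 N.dim) V _).1
    ((Hom.contMDiff f).comp contMDiff_subtype_val)

/-- The restriction of a smooth map to open submanifolds. -/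
noncomputable def restrict {M N : Mfd.{u}} (f : M ⟶ N) (U : TopologicalSpace.Opens M)
    (V : TopologicalSpace.Opens N) (h : ∀ x ∈ U, Hom.toFun f x ∈ V) :
    M.ofOpens U ⟶ N.ofOpens V :=
  Hom.mk (M := M.ofOpens U) (N := N.ofOpens V) (fun x => ⟨Hom.toFun f x.1, h x.1 x.2⟩)
    (contMDiff_restrict f U V h)

end Mfd

namespace KanTruncated

section Kan

variable {C : Type*} [Category C] {n : ℕ}

/-- The `(m, i)`-horn, regarded as a functor on the category of the ordinals `[0], …, [n]`. -/
abbrev hornWeight (n m : ℕ) (i : Fin (m + 1)) : SSet.Truncated.{0} n :=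
  (SSet.truncation n).obj (SSet.horn.{0} m i).toSSet

/-- The `m`-th term `Y_m` of an `n`-simplicial object, for `m ≤ n`. -/
abbrev term (Y : SimplicialObject.Truncated C n) (m : ℕ) (hm : m ≤ n) : C :=
  Y.obj (op ⟨⦋m⦌, hm⟩)

/-- For a simplex `x : [k] → [m]` of the horn, the structure map `Y(x) : Y_m ⟶ Y_k`.
When `x` is the `j`-th coface this is the `j`-th face map. -/
def hornRestriction (Y : SimplicialObject.Truncated C n) (m : ℕ) (hm : m ≤ n) (i : Fin (m + 1))
    ⦃k : (SimplexCategory.Truncated n)ᵒᵖ⦄ (x : (hornWeight n m i).obj k) :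
    term Y m hm ⟶ Y.obj k :=
  Y.map (Quiver.Hom.op (X := k.unop) (Y := ⟨⦋m⦌, hm⟩)
    (SimplexCategory.Truncated.Hom.tr (a := k.unop.obj) (b := ⦋m⦌)
      (SSet.stdSimplex.objEquiv x.1) k.unop.property hm))

theorem hornRestriction_naturality (Y : SimplicialObject.Truncated C n) (m : ℕ) (hm : m ≤ n)
    (i : Fin (m + 1)) ⦃k l : (SimplexCategory.Truncated n)ᵒᵖ⦄ (x : (hornWeight n m i).obj k)
    (f : k ⟶ l) :
    hornRestriction Y m hm i x ≫ Y.map f =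
      hornRestriction Y m hm i ((hornWeight n m i).map f x) := by
  unfold hornRestriction
  rw [← Y.map_comp]
  rfl

/-- The Kan condition `Kan(m, i)` for an `n`-simplicial object `Y`, with respect to a class `cov`
of covers: the horn space, i.e. the limit of `Y` weighted by the `(m, i)`-horn, exists, and the
horn projection `Y_m ⟶ Λ^m_i(Y)`, i.e. the morphism induced by the structure maps of `Y`
(with components the face maps `d_j`, `j ≠ i`), is a cover. -/
def KanCondition (cov : MorphismProperty C) (Y : SimplicialObject.Truncated C n)
    (m : ℕ) (hm : m ≤ n) (i : Fin (m + 1)) : Prop :=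
  ∃ (L : WeightedCone (hornWeight n m i) Y) (hL : WeightedCone.IsLimit L),
    cov (WeightedCone.IsLimit.lift hL (hornRestriction Y m hm i)
      (hornRestriction_naturality Y m hm i))

end Kan

/-- A Kan `n`-simplicial manifold: an `n`-simplicial manifold satisfying `Kan(m, i)` with respect
to submersions, for all `1 ≤ m ≤ n` and `0 ≤ i ≤ m`. -/
def IsKanManifold {n : ℕ} (Y : SimplicialObject.Truncated Mfd.{u} n) : Prop :=
  ∀ (m : ℕ) (hm : m ≤ n), 1 ≤ m → ∀ i : Fin (m + 1), KanCondition Mfd.submersions Y m hm i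

/-- The embedding `X_0 → X_k` of the base space, the iterated degeneracy map
induced by `[k] → [0]`. -/
def baseInclusion (X : SimplicialObject Mfd.{u}) (k : SimplexCategory) :
    X.obj (op ⦋0⦌) ⟶ X.obj (op k) :=
  X.map (k.const ⦋0⦌ 0).op

/-- The data of an `n`-simplicial manifold induced by a simplicial manifold `X`: open
neighbourhoods of `X_0` in `X_0, …, X_n` that are preserved by the structure maps of `X` between
these levels. -/
structure Induced (X : SimplicialObject Mfd.{u}) (n : ℕ) where
  nbhd (k : (SimplexCategory.Truncated n)ᵒᵖ) :
    TopologicalSpace.Opens (((SimplicialObject.truncation n).obj X).obj k)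
  base_mem (k : (SimplexCategory.Truncated n)ᵒᵖ) (x : X.obj (op ⦋0⦌)) :
    Mfd.Hom.toFun (baseInclusion X k.unop.obj) x ∈ nbhd k
  map_mem {k l : (SimplexCategory.Truncated n)ᵒᵖ} (f : k ⟶ l) :
    ∀ x ∈ nbhd k, Mfd.Hom.toFun (((SimplicialObject.truncation n).obj X).map f) x ∈ nbhd l

/-- The `n`-simplicial manifold consisting of the given open submanifolds of `X_0, …, X_n`, with
the structure maps restricted from `X`. -/
noncomputable def Induced.toTruncated {X : SimplicialObject Mfd.{u}} {n : ℕ} (U : Induced X n) :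
    SimplicialObject.Truncated Mfd.{u} n where
  obj k := (((SimplicialObject.truncation n).obj X).obj k).ofOpens (U.nbhd k)
  map {k l} f := Mfd.restrict (((SimplicialObject.truncation n).obj X).map f)
    (U.nbhd k) (U.nbhd l) (U.map_mem f)
  map_id k := by
    apply Mfd.Hom.ext
    funext x
    apply Subtype.ext
    change Mfd.Hom.toFun (((SimplicialObject.truncation n).obj X).map (𝟙 k)) x.1 = x.1
    rw [CategoryTheory.Functor.map_id]
    rfl
  map_comp {k l m} f g := by
    apply Mfd.Hom.ext
    funext x
    apply Subtype.ext
    change Mfd.Hom.toFun (((SimplicialObject.truncation n).obj X).map (f ≫ g)) x.1 = _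
    rw [CategoryTheory.Functor.map_comp]
    rfl

end KanTruncated

/-! At a point x of X_0 the tangent spaces of the X_m form a simplicial vector space, and these
satisfy the Kan condition by Moore's argument (`exists_filler`): the prescribed faces are matched
one at a time, with corrections given by degeneracies. So at a degenerate point the derivative of
the horn projection is onto the limit of the tangent spaces. Its kernel, the vectors killed by all
faces but one, has a dimension determined by the dimensions of the X_m (`finrank_moore`). The rank
is therefore the same at every x, even if X_0 is disconnected.

A horn space is the set of compatible families in a finite product of manifolds, cut out by
equations. The statement on tangent spaces says that these equations and the horn projection are
exact to first order. The inverse function theorem then shows that, near a degenerate horn, the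
compatible families form a submanifold parametrized by X_{m+1}, onto which the horn projection is a
submersion (`exists_local_parametrization`, `exists_localChart`).

Closeness to a degenerate horn has to follow from the smallness of the individual faces. All faces
of the horn share the vertex i, so they lie in one fibre of the vertex maps X_m → X_0. A tube of
variable radius around X_0 then suffices (`exists_open_tube`, `exists_open_horn`). Finally U_k
consists of the points whose images under all structure maps lie in the finitely many chosen
neighbourhoods. -/

open Filter Topology Set

/-! ### Inverse function theorem and parametrization of zero sets -/

section Euclidean

variable {E F G H : Type*} [NormedAddCommGroup E] [NormedSpace ℝ E] [NormedAddCommGroup F]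
  [NormedSpace ℝ F] [NormedAddCommGroup G] [NormedSpace ℝ G] [NormedAddCommGroup H]
  [NormedSpace ℝ H]

/-- The inverse function theorem, with smoothness in both directions on the whole domain. -/
theorem exists_smooth_openPartialHomeomorph [CompleteSpace E] {f : E → F} {a : E} (e : E ≃L[ℝ] F)
    (hf : ∀ᶠ x in 𝓝 a, ContDiffAt ℝ ∞ f x) (he : HasFDerivAt f (e : E →L[ℝ] F) a) :
    ∃ g : OpenPartialHomeomorph E F, (g : E → F) = f ∧ a ∈ g.source ∧
      (∀ x ∈ g.source, ContDiffAt ℝ ∞ f x) ∧ ∀ y ∈ g.target, ContDiffAt ℝ ∞ g.symm y := by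
  have ha : ContDiffAt ℝ ∞ f a := hf.self_of_nhds
  have hopen : ∀ᶠ x in 𝓝 a, fderiv ℝ f x ∈
      Set.range (ContinuousLinearEquiv.toContinuousLinearMap : (E ≃L[ℝ] F) → E →L[ℝ] F) :=
    (ha.continuousAt_fderiv (by simp)).preimage_mem_nhds
      (ContinuousLinearEquiv.isOpen.mem_nhds ⟨e, he.fderiv.symm⟩)
  obtain ⟨s, hs, hso, has⟩ := eventually_nhds_iff.1 (hf.and hopen)
  let g₀ := ha.toOpenPartialHomeomorph f he (by simp)
  have hsrc : ∀ x ∈ (g₀.restrOpen s hso).source, x ∈ s := fun x hx ↦ by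
    rw [OpenPartialHomeomorph.restrOpen_source] at hx
    exact hx.2
  refine ⟨g₀.restrOpen s hso, rfl, ?_, fun x hx ↦ (hs x (hsrc x hx)).1, fun y hy ↦ ?_⟩
  · rw [OpenPartialHomeomorph.restrOpen_source]
    exact ⟨ha.mem_toOpenPartialHomeomorph_source he (by simp), has⟩
  · obtain ⟨h₁, e', he'⟩ := hs _ (hsrc _ ((g₀.restrOpen s hso).map_target hy))
    refine OpenPartialHomeomorph.contDiffAt_symm _ hy (f₀' := e') ?_ h₁
    rw [he']
    exact (h₁.differentiableAt (by simp)).hasFDerivAt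

/-- If `E → G → H` is a pair of smooth maps with zero composition and whose derivatives are exact
at `G`, then the zero set of the second map is locally parametrized by the first one. -/
theorem exists_local_parametrization [FiniteDimensional ℝ E] [FiniteDimensional ℝ G]
    [FiniteDimensional ℝ H] {D : E → G} {A : G → H} {p : E} {D' : E →L[ℝ] G} {A' : G →L[ℝ] H}
    (hD : ∀ᶠ x in 𝓝 p, ContDiffAt ℝ ∞ D x) (hD' : HasFDerivAt D D' p)
    (hA : ContDiffAt ℝ ∞ A (D p)) (hA' : HasFDerivAt A A' (D p))
    (hAD : ∀ᶠ x in 𝓝 p, A (D x) = 0) (hex : ∀ v, A' v = 0 → ∃ u, D' u = v)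
    {d : ℕ} (hd : Module.finrank ℝ (LinearMap.range D'.toLinearMap) = d) :
    ∃ (π : G →L[ℝ] EuclideanSpace ℝ (Fin d)) (τ : EuclideanSpace ℝ (Fin d) → E),
      (∀ᶠ t in 𝓝 (π (D p)), ContDiffAt ℝ ∞ τ t) ∧ τ (π (D p)) = p ∧
      (∀ᶠ t in 𝓝 (π (D p)), π (D (τ t)) = t) ∧
      (∀ᶠ y in 𝓝 (D p), A y = 0 → D (τ (π y)) = y) ∧
      Function.Surjective (π.comp D') := by
  have : CompleteSpace E := FiniteDimensional.complete ℝ E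
  have : CompleteSpace G := FiniteDimensional.complete ℝ G
  let K := LinearMap.range D'.toLinearMap
  let ε : K ≃L[ℝ] EuclideanSpace ℝ (Fin d) :=
    ContinuousLinearEquiv.ofFinrankEq (by rw [hd, finrank_euclideanSpace_fin])
  obtain ⟨P, hP⟩ := LinearMap.exists_leftInverse_of_injective K.subtype (by simp)
  let π : G →L[ℝ] EuclideanSpace ℝ (Fin d) := (ε : K →L[ℝ] _).comp P.toContinuousLinearMap
  let ι : EuclideanSpace ℝ (Fin d) →L[ℝ] G := K.subtypeL.comp (ε.symm : _ →L[ℝ] K)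
  have hPk : ∀ k : K, P k = k := fun k ↦ LinearMap.congr_fun hP k
  have hπι : ∀ t, π (ι t) = t := fun t ↦ by
    change ε (P (ε.symm t : K)) = t
    rw [hPk, ε.apply_symm_apply]
  have hιπ : ∀ w, ι (π (D' w)) = D' w := fun w ↦ by
    change ((ε.symm (ε (P (D' w))) : K) : G) = D' w
    rw [ε.symm_apply_apply]
    exact congrArg Subtype.val (hPk ⟨D' w, w, rfl⟩)
  have hsurj : Function.Surjective (π.comp D') := fun t ↦ by
    obtain ⟨w, hw⟩ := (ε.symm t).2
    refine ⟨w, ?_⟩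
    have : D' w = ι t := hw
    rw [ContinuousLinearMap.comp_apply, this, hπι]
  obtain ⟨s, hs⟩ := LinearMap.exists_rightInverse_of_surjective A'.toLinearMap.rangeRestrict
    (LinearMap.range_rangeRestrict _)
  -- `B` is built so that `ι ∘ π + B ∘ A'` is the identity: `v - s (A' v)` lies in the kernel of
  -- `A'`, hence in the range of `D'`, where `ι ∘ π` is the identity.
  obtain ⟨B₀, hB₀⟩ := LinearMap.exists_extend
    ((LinearMap.id - (ι.comp π).toLinearMap) ∘ₗ s)
  let B := B₀.toContinuousLinearMap
  have hBA : ∀ v, ι (π v) + B (A' v) = v := fun v ↦ by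
    let r : LinearMap.range A'.toLinearMap := A'.toLinearMap.rangeRestrict v
    have h₁ : B (A' v) = s r - ι (π (s r)) := LinearMap.congr_fun hB₀ r
    have h₂ : A' (s r) = A' v := congrArg Subtype.val (LinearMap.congr_fun hs r)
    obtain ⟨w, hw⟩ := hex (v - s r) (by rw [map_sub, h₂, sub_self])
    have h₃ := hιπ w
    rw [hw, map_sub, map_sub] at h₃
    rw [h₁, ← sub_eq_zero, ← sub_eq_zero.2 h₃]
    abel
  obtain ⟨R, hR⟩ := ContinuousLinearMap.exists_rightInverse_of_surjective (π.comp D')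
    (LinearMap.range_eq_top.2 hsurj)
  set t₀ := π (D p) with ht₀
  -- An affine slice through `p` on which `π ∘ D` has derivative the identity; inverting it gives `τ
  -- = ρ ∘ g.symm`.
  let ρ : EuclideanSpace ℝ (Fin d) → E := fun t ↦ p + R (t - t₀)
  have hρ₀ : ρ t₀ = p := by simp [ρ]
  have hρ : ContDiff ℝ ∞ ρ := by fun_prop
  have hρ' : HasFDerivAt ρ R t₀ := by
    have := (R.hasFDerivAt (x := t₀ - t₀)).comp (f := fun t ↦ t - t₀) t₀
      ((hasFDerivAt_id t₀).sub_const t₀)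
    simpa [ρ, Function.comp_def] using this.const_add p
  obtain ⟨g, hg, hg₀, -, hgs⟩ := exists_smooth_openPartialHomeomorph
    (f := fun t ↦ π (D (ρ t))) (a := t₀) (ContinuousLinearEquiv.refl ℝ _) (by
      have : Tendsto ρ (𝓝 t₀) (𝓝 p) := hρ₀ ▸ hρ.continuous.continuousAt
      filter_upwards [this.eventually hD] with t ht
      exact π.contDiff.contDiffAt.comp t (ht.comp t hρ.contDiffAt)) (by
      have h₁ : HasFDerivAt D D' (ρ t₀) := hρ₀ ▸ hD'
      have := (π.hasFDerivAt (x := D (ρ t₀))).comp t₀ (h₁.comp t₀ hρ')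
      convert! this using 1
      rw [← ContinuousLinearMap.comp_assoc, hR]
      rfl)
  have hgt : g t₀ = t₀ := by rw [hg]; simp only [hρ₀, ← ht₀]
  have ht₀t : t₀ ∈ g.target := by
    have := g.map_source hg₀
    rwa [hgt] at this
  have hgst : g.symm t₀ = t₀ := by
    conv_lhs => rw [← hgt]
    exact g.left_inv hg₀
  have hτc : ContinuousAt (fun t ↦ ρ (g.symm t)) t₀ :=
    hρ.continuous.continuousAt.comp (hgs _ ht₀t).continuousAt
  have hright : ∀ᶠ t in 𝓝 t₀, π (D (ρ (g.symm t))) = t := by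
    filter_upwards [g.open_target.mem_nhds ht₀t] with t ht
    have := g.right_inv ht
    rwa [hg] at this
  refine ⟨π, fun t ↦ ρ (g.symm t), ?_, ?_, hright, ?_, hsurj⟩
  · filter_upwards [g.open_target.mem_nhds ht₀t] with t ht
    exact hρ.contDiffAt.comp t (hgs t ht)
  · simp only [← ht₀, hgst, hρ₀]
  -- `Ψ` is injective near `D p`. On zeros of `A` it depends only on `π y`, so `y` and `D (τ (π
  -- y))`, which have the same `π`, coincide.
  · let Ψ : G → G := fun y ↦ ι (π y) + B (A y)
    have hΨ : HasStrictFDerivAt Ψ ((ContinuousLinearEquiv.refl ℝ G : G ≃L[ℝ] G) : G →L[ℝ] G)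
        (D p) := by
      have h₁ : HasStrictFDerivAt A A' (D p) := hA.hasStrictFDerivAt' hA' (by simp)
      have h₂ := ((ι.comp π).hasStrictFDerivAt (x := D p)).add
        ((B.hasStrictFDerivAt (x := A (D p))).comp (D p) h₁)
      convert! h₂ using 1
      ext v
      exact (hBA v).symm
    have hinj := hΨ.eventually_left_inverse
    have hback : Tendsto (fun y ↦ D (ρ (g.symm (π y)))) (𝓝 (D p)) (𝓝 (D p)) := by
      have h₁ : Tendsto (fun t ↦ ρ (g.symm t)) (𝓝 t₀) (𝓝 p) := by
        have := hτc.tendsto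
        simpa only [hgst, hρ₀] using this
      exact (hD.self_of_nhds.continuousAt.tendsto.comp h₁).comp π.continuous.continuousAt.tendsto
    have hπ : Tendsto π (𝓝 (D p)) (𝓝 t₀) := π.continuous.continuousAt
    have hρt : Tendsto (fun t ↦ ρ (g.symm t)) (𝓝 t₀) (𝓝 p) := by
      have := hτc.tendsto
      simpa only [hgst, hρ₀] using this
    filter_upwards [hinj, hback.eventually hinj, hπ.eventually hright,
      (hρt.comp hπ).eventually hAD] with y h₁ h₂ h₃ h₄ hAy
    have h₅ : Ψ (D (ρ (g.symm (π y)))) = Ψ y := by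
      simp only [Function.comp_apply] at h₄
      simp only [Ψ, h₃, h₄, hAy]
    rw [h₅, h₁] at h₂
    exact h₂.symm

end Euclidean

/-! ### Submersions from surjective derivatives -/

section Charts

variable {a b : ℕ} {M N : Type*} [TopologicalSpace M] [ChartedSpace (EuclideanSpace ℝ (Fin a)) M]
  [TopologicalSpace N] [ChartedSpace (EuclideanSpace ℝ (Fin b)) N]

/-- The point `y` is kept apart from `f x` because the transition maps of a diagram are read in
charts at members of a family, equal to `f x` only through compatibility. -/
theorem HasMFDerivAt.hasFDerivAt_chart {f : M → N} {x : M} {y : N} (hy : f x = y)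
    {f' : EuclideanSpace ℝ (Fin a) →L[ℝ] EuclideanSpace ℝ (Fin b)}
    (hf : HasMFDerivAt (𝓡 a) (𝓡 b) f x f') :
    HasFDerivAt (fun z ↦ chartAt (EuclideanSpace ℝ (Fin b)) y
      (f ((chartAt (EuclideanSpace ℝ (Fin a)) x).symm z))) f'
      (chartAt (EuclideanSpace ℝ (Fin a)) x x) := by
  subst hy
  have := hf.2
  rw [modelWithCornersSelf_coe, Set.range_id] at this
  exact HasFDerivWithinAt.hasFDerivAt_of_univ this

variable [IsManifold (𝓡 a) ∞ M] [IsManifold (𝓡 b) ∞ N]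

theorem eventually_contDiffAt_chart {f : M → N} {x : M} {y : N} (hy : f x = y)
    (hf : ∀ᶠ x' in 𝓝 x, ContMDiffAt (𝓡 a) (𝓡 b) ∞ f x') :
    ∀ᶠ z in 𝓝 (chartAt (EuclideanSpace ℝ (Fin a)) x x),
      ContDiffAt ℝ ∞ (fun z ↦ chartAt (EuclideanSpace ℝ (Fin b)) y
        (f ((chartAt (EuclideanSpace ℝ (Fin a)) x).symm z))) z := by
  subst hy
  set φ := chartAt (EuclideanSpace ℝ (Fin a)) x
  set ψ := chartAt (EuclideanSpace ℝ (Fin b)) (f x)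
  have hx : x ∈ φ.source := mem_chart_source _ x
  have h₁ : ∀ᶠ x' in 𝓝 x, f x' ∈ ψ.source :=
    hf.self_of_nhds.continuousAt (ψ.open_source.mem_nhds (mem_chart_source _ (f x)))
  have h₂ : Tendsto φ.symm (𝓝 (φ x)) (𝓝 x) := by
    have := φ.continuousAt_symm (φ.map_source hx)
    rwa [ContinuousAt, φ.left_inv hx] at this
  filter_upwards [h₂.eventually (hf.and h₁), φ.open_target.mem_nhds (φ.map_source hx)]
    with z hz hzt
  rw [← contMDiffAt_iff_contDiffAt]
  have h₃ : ContMDiffAt (𝓡 a) (𝓡 a) ∞ φ.symm z :=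
    contMDiffAt_symm_of_mem_maximalAtlas (IsManifold.chart_mem_maximalAtlas x) hzt
  have h₄ : ContMDiffAt (𝓡 b) (𝓡 b) ∞ ψ (f (φ.symm z)) :=
    contMDiffAt_of_mem_maximalAtlas (IsManifold.chart_mem_maximalAtlas (f x)) hz.2
  exact h₄.comp z (hz.1.comp z h₃)

/-- A smooth map between finite-dimensional manifolds whose derivative at a point is surjective is
a submersion at this point. -/
theorem isSubmersionAtOfComplement_of_surjective_mfderiv {f : M → N} {x : M}
    (hf : ∀ᶠ x' in 𝓝 x, ContMDiffAt (𝓡 a) (𝓡 b) ∞ f x')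
    (hsurj : Function.Surjective (mfderiv (𝓡 a) (𝓡 b) f x)) :
    Manifold.IsSubmersionAtOfComplement (EuclideanSpace ℝ (Fin (a - b))) (𝓡 a) (𝓡 b) ∞ f x := by
  set φ := chartAt (EuclideanSpace ℝ (Fin a)) x with hφ
  set ψ := chartAt (EuclideanSpace ℝ (Fin b)) (f x) with hψ
  let L : EuclideanSpace ℝ (Fin a) →L[ℝ] EuclideanSpace ℝ (Fin b) := mfderiv (𝓡 a) (𝓡 b) f x
  have hL : Function.Surjective L := hsurj
  let f' : EuclideanSpace ℝ (Fin a) → EuclideanSpace ℝ (Fin b) := fun z ↦ ψ (f (φ.symm z))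
  have hfL : HasFDerivAt f' L (φ x) := HasMFDerivAt.hasFDerivAt_chart rfl
    (hf.self_of_nhds.mdifferentiableAt (by simp)).hasMFDerivAt
  have hf's : ∀ᶠ z in 𝓝 (φ x), ContDiffAt ℝ ∞ f' z := eventually_contDiffAt_chart rfl hf
  have hker : Module.finrank ℝ (LinearMap.ker L.toLinearMap) = a - b := by
    have := LinearMap.finrank_range_add_finrank_ker L.toLinearMap
    rw [LinearMap.range_eq_top.2 hL, finrank_top, finrank_euclideanSpace_fin,
      finrank_euclideanSpace_fin] at this
    omega
  let κ : LinearMap.ker L.toLinearMap ≃L[ℝ] EuclideanSpace ℝ (Fin (a - b)) :=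
    ContinuousLinearEquiv.ofFinrankEq (by rw [hker, finrank_euclideanSpace_fin])
  obtain ⟨P, hP⟩ := LinearMap.exists_leftInverse_of_injective
    (LinearMap.ker L.toLinearMap).subtype (by simp)
  let e₀ : EuclideanSpace ℝ (Fin a) →ₗ[ℝ]
      EuclideanSpace ℝ (Fin b) × EuclideanSpace ℝ (Fin (a - b)) :=
    L.toLinearMap.prod (κ.toLinearEquiv.toLinearMap ∘ₗ P)
  have he₀ : Function.Injective e₀ := by
    rw [← LinearMap.ker_eq_bot, LinearMap.ker_eq_bot']
    intro v hv
    have h₁ : L v = 0 := congrArg Prod.fst hv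
    have h₂ : κ (P v) = 0 := congrArg Prod.snd hv
    have h₃ : P v = ⟨v, h₁⟩ := LinearMap.congr_fun hP ⟨v, h₁⟩
    have h₄ : P v = 0 := by simpa using h₂
    exact congrArg Subtype.val (h₃.symm.trans h₄)
  have hba : b ≤ a := by
    have := LinearMap.finrank_le_finrank_of_surjective (f := L.toLinearMap) hL
    simpa using this
  have hdim : Module.finrank ℝ (EuclideanSpace ℝ (Fin a)) = Module.finrank ℝ
      (EuclideanSpace ℝ (Fin b) × EuclideanSpace ℝ (Fin (a - b))) := by
    simp; omega
  let e : EuclideanSpace ℝ (Fin a) ≃L[ℝ]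
      EuclideanSpace ℝ (Fin b) × EuclideanSpace ℝ (Fin (a - b)) :=
    (LinearEquiv.ofInjectiveOfFinrankEq e₀ he₀ hdim).toContinuousLinearEquiv
  have he : ∀ v, e v = e₀ v := fun v ↦ rfl
  let κP := (κ : _ →L[ℝ] EuclideanSpace ℝ (Fin (a - b))).comp P.toContinuousLinearMap
  -- The chart correction: `e ∘ h` has first component `f'`, so `f` becomes the first projection.
  -- Applying `e.symm` makes the derivative of `h` at `φ x` the identity.
  let h : EuclideanSpace ℝ (Fin a) → EuclideanSpace ℝ (Fin a) :=
    fun z ↦ e.symm (f' z, κP z)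
  obtain ⟨g, hg, hgx, hgs, hgt⟩ := exists_smooth_openPartialHomeomorph (f := h) (a := φ x)
    (ContinuousLinearEquiv.refl ℝ _) (by
      filter_upwards [hf's] with z hz
      exact e.symm.contDiff.contDiffAt.comp z (hz.prodMk κP.contDiff.contDiffAt)) (by
      have h₁ := (e.symm.hasFDerivAt (x := (f' (φ x), κP (φ x)))).comp (φ x)
        (hfL.prodMk κP.hasFDerivAt)
      convert! h₁ using 1
      ext1 v
      exact (e.symm_apply_apply v).symm)
  have hx : x ∈ φ.source := mem_chart_source _ x
  have hφm : φ ∈ IsManifold.maximalAtlas (𝓡 a) ∞ M := IsManifold.chart_mem_maximalAtlas x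
  refine Manifold.IsSubmersionAtOfComplement.mk_of_continuousAt hf.self_of_nhds.continuousAt
    e (φ.trans g) ψ ?_ (mem_chart_source _ (f x)) ?_ (IsManifold.chart_mem_maximalAtlas (f x)) ?_
  · rw [OpenPartialHomeomorph.trans_source]
    exact ⟨hx, hgx⟩
  · refine OpenPartialHomeomorph.mem_maximalAtlas_of_contMDiffOn _ ?_ ?_
    · rw [OpenPartialHomeomorph.trans_source]
      intro y hy
      have h₁ : ContMDiffAt (𝓡 a) (𝓡 a) ∞ g (φ y) := by
        rw [hg]; exact (hgs _ hy.2).contMDiffAt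
      exact (h₁.comp y (contMDiffAt_of_mem_maximalAtlas hφm hy.1)).contMDiffWithinAt
    · rw [OpenPartialHomeomorph.trans_target]
      intro z hz
      have h₁ : ContMDiffAt (𝓡 a) (𝓡 a) ∞ g.symm z := (hgt _ hz.1).contMDiffAt
      exact ((contMDiffAt_symm_of_mem_maximalAtlas hφm hz.2).comp z h₁).contMDiffWithinAt
  · intro z hz
    have hz' : z ∈ (φ.trans g).target := by simpa using hz
    rw [OpenPartialHomeomorph.trans_target] at hz'
    have h₁ : h (g.symm z) = z := by
      have := g.right_inv hz'.1
      rwa [hg] at this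
    have h₂ : e z = (f' (g.symm z), κP (g.symm z)) := by
      conv_lhs => rw [← h₁]
      exact e.apply_symm_apply _
    change ψ (f (φ.symm (g.symm z))) = (e z).1
    rw [h₂]

end Charts

/-! ### Local charts of subsets of products -/

/-- A smooth parametrization of an open part of a subset `S` of a finite product of manifolds,
whose inverse is the restriction of a linear map in a product chart. -/
structure LocalChart {ι : Type} [Fintype ι] (X : ι → Mfd.{u}) (S : Set (∀ e, X e)) (d : ℕ) where
  chart (e : ι) : OpenPartialHomeomorph (X e) (EuclideanSpace ℝ (Fin (X e).dim))
  chart_mem (e : ι) : chart e ∈ IsManifold.maximalAtlas (𝓡 (X e).dim) ∞ (X e)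
  proj : (∀ e, EuclideanSpace ℝ (Fin (X e).dim)) →L[ℝ] EuclideanSpace ℝ (Fin d)
  dom : Set (∀ e, X e)
  isOpen_dom : IsOpen dom
  mem_source {y : ∀ e, X e} (hy : y ∈ dom) (e : ι) : y e ∈ (chart e).source
  target : Set (EuclideanSpace ℝ (Fin d))
  isOpen_target : IsOpen target
  param : EuclideanSpace ℝ (Fin d) → ∀ e, X e
  contMDiffOn_param (e : ι) : ContMDiffOn (𝓡 d) (𝓡 (X e).dim) ∞ (fun t ↦ param t e) target
  param_mem {t : EuclideanSpace ℝ (Fin d)} (ht : t ∈ target) : param t ∈ S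
  param_mem_dom {t : EuclideanSpace ℝ (Fin d)} (ht : t ∈ target) : param t ∈ dom
  proj_param {t : EuclideanSpace ℝ (Fin d)} (ht : t ∈ target) :
    proj (fun e ↦ chart e (param t e)) = t
  proj_mem {y : ∀ e, X e} (hy : y ∈ S) (hy' : y ∈ dom) : proj (fun e ↦ chart e (y e)) ∈ target
  param_proj {y : ∀ e, X e} (hy : y ∈ S) (hy' : y ∈ dom) :
    param (proj (fun e ↦ chart e (y e))) = y

namespace LocalChart

variable {ι : Type} [Fintype ι] {X : ι → Mfd.{u}} {S : Set (∀ e, X e)} {d : ℕ}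

/-- The coordinates given by a local chart. -/
def coord (χ : LocalChart X S d) (y : ∀ e, X e) : EuclideanSpace ℝ (Fin d) :=
  χ.proj (fun e ↦ χ.chart e (y e))

theorem contMDiffAt_coord (χ : LocalChart X S d) {E H Z : Type*} [NormedAddCommGroup E]
    [NormedSpace ℝ E] [TopologicalSpace H] {I : ModelWithCorners ℝ E H} [TopologicalSpace Z]
    [ChartedSpace H Z] {g : Z → ∀ e, X e} {z : Z}
    (hg : ∀ e, ContMDiffAt I (𝓡 (X e).dim) ∞ (fun z ↦ g z e) z) (hz : g z ∈ χ.dom) :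
    ContMDiffAt I (𝓡 d) ∞ (fun z ↦ χ.coord (g z)) z := by
  have h₁ : ContMDiffAt I 𝓘(ℝ, ∀ e, EuclideanSpace ℝ (Fin (X e).dim)) ∞
      (fun z e ↦ χ.chart e (g z e)) z := by
    rw [contMDiffAt_pi_space]
    intro e
    have h₂ : ContMDiffAt (𝓡 (X e).dim) (𝓡 (X e).dim) ∞ (χ.chart e) (g z e) :=
      contMDiffAt_of_mem_maximalAtlas (χ.chart_mem e) (χ.mem_source hz e)
    exact h₂.comp z (hg e)
  exact χ.proj.contDiff.contMDiff.contMDiffAt.comp z h₁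

/-- The restriction of a local chart to an open subset. -/
def restrict (χ : LocalChart X S d) (Ω : Set (∀ e, X e)) (hΩ : IsOpen Ω) :
    LocalChart X (S ∩ Ω) d where
  chart := χ.chart
  chart_mem := χ.chart_mem
  proj := χ.proj
  dom := χ.dom
  isOpen_dom := χ.isOpen_dom
  mem_source := χ.mem_source
  target := χ.target ∩ χ.param ⁻¹' Ω
  isOpen_target := (continuousOn_pi.2 fun e ↦ (χ.contMDiffOn_param e).continuousOn
    ).isOpen_inter_preimage χ.isOpen_target hΩ
  param := χ.param
  contMDiffOn_param e := (χ.contMDiffOn_param e).mono inter_subset_left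
  param_mem ht := ⟨χ.param_mem ht.1, ht.2⟩
  param_mem_dom ht := χ.param_mem_dom ht.1
  proj_param ht := χ.proj_param ht.1
  proj_mem hy hy' := ⟨χ.proj_mem hy.1 hy', by
    rw [mem_preimage, χ.param_proj hy.1 hy']; exact hy.2⟩
  param_proj hy hy' := χ.param_proj hy.1 hy'

open Classical in
/-- The chart of `S` given by a local chart. -/
noncomputable def homeo (χ : LocalChart X S d) (y₀ : S) :
    OpenPartialHomeomorph S (EuclideanSpace ℝ (Fin d)) where
  toFun y := χ.coord y.1
  invFun t := if h : t ∈ χ.target then ⟨χ.param t, χ.param_mem h⟩ else y₀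
  source := {y | y.1 ∈ χ.dom}
  target := χ.target
  map_source' y hy := χ.proj_mem y.2 hy
  map_target' t ht := by
    rw [dif_pos ht]
    exact χ.param_mem_dom ht
  left_inv' y hy := by
    rw [dif_pos (show χ.coord y.1 ∈ χ.target from χ.proj_mem y.2 hy)]
    exact Subtype.ext (χ.param_proj y.2 hy)
  right_inv' t ht := by
    rw [dif_pos ht]
    exact χ.proj_param ht
  open_source := χ.isOpen_dom.preimage continuous_subtype_val
  open_target := χ.isOpen_target
  continuousOn_toFun := by
    refine χ.proj.continuous.comp_continuousOn (continuousOn_pi.2 fun e ↦ ?_)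
    exact (χ.chart e).continuousOn.comp
      ((continuous_apply e).comp continuous_subtype_val).continuousOn
      fun y hy ↦ χ.mem_source hy e
  continuousOn_invFun := by
    rw [Topology.IsInducing.subtypeVal.continuousOn_iff]
    refine (continuousOn_pi.2 fun e ↦ (χ.contMDiffOn_param e).continuousOn).congr
      fun t ht ↦ ?_
    simp only [Function.comp_apply, dif_pos ht]

theorem homeo_symm_apply (χ : LocalChart X S d) (y₀ : S) {t : EuclideanSpace ℝ (Fin d)}
    (ht : t ∈ χ.target) : ((χ.homeo y₀).symm t).1 = χ.param t := by
  classical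
  change (dite (t ∈ χ.target) _ _ : S).1 = _
  rw [dif_pos ht]

end LocalChart

/-! ### Submanifolds covered by local charts -/

section OfLocalCharts

variable {ι : Type} [Fintype ι] (X : ι → Mfd.{u}) (S : Set (∀ e, X e)) (d : ℕ)
  (hS : ∀ y : S, ∃ χ : LocalChart X S d, y.1 ∈ χ.dom)

/-- The charted space structure on a set covered by local charts. -/
@[reducible]
noncomputable def chartedSpaceOfLocalCharts : ChartedSpace (EuclideanSpace ℝ (Fin d)) S where
  atlas := Set.range fun y ↦ (hS y).choose.homeo y
  chartAt y := (hS y).choose.homeo y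
  mem_chart_source y := (hS y).choose_spec
  chart_mem_atlas y := ⟨y, rfl⟩

/-- A transition map is the coordinate map of one local chart, smooth on an open subset of the
ambient product, after the smooth parametrization of the other. No compatibility of local charts has
to be assumed. -/
theorem isManifoldOfLocalCharts :
    let := chartedSpaceOfLocalCharts X S d hS
    IsManifold (𝓡 d) ∞ S := by
  let := chartedSpaceOfLocalCharts X S d hS
  refine isManifold_of_contDiffOn _ _ _ ?_
  rintro _ _ ⟨y, rfl⟩ ⟨y', rfl⟩
  set χ := (hS y).choose
  set χ' := (hS y').choose
  simp only [modelWithCornersSelf_coe, modelWithCornersSelf_coe_symm, Function.id_comp,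
    Function.comp_id, range_id, inter_univ, preimage_id]
  intro t ht
  rw [OpenPartialHomeomorph.trans_source] at ht
  have ht₁ : t ∈ χ.target := ht.1
  have ht₂ : ((χ.homeo y).symm t).1 ∈ χ'.dom := ht.2
  rw [χ.homeo_symm_apply y ht₁] at ht₂
  have h₁ : ContMDiffAt (𝓡 d) (𝓡 d) ∞ (fun t ↦ χ'.coord (χ.param t)) t :=
    χ'.contMDiffAt_coord (fun e ↦
      (χ.contMDiffOn_param e).contMDiffAt (χ.isOpen_target.mem_nhds ht₁)) ht₂
  refine (ContDiffAt.congr_of_eventuallyEq h₁.contDiffAt ?_).contDiffWithinAt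
  filter_upwards [χ.isOpen_target.mem_nhds ht₁] with t' ht'
  change χ'.coord ((χ.homeo y).symm t').1 = _
  rw [χ.homeo_symm_apply y ht']

/-- The manifold structure on a set covered by local charts. -/
noncomputable def Mfd.ofLocalCharts : Mfd.{u} :=
  letI := chartedSpaceOfLocalCharts X S d hS
  haveI := isManifoldOfLocalCharts X S d hS
  { carrier := S
    dim := d }

namespace Mfd.ofLocalCharts

variable {X S d}

/-- A point of the ambient product. -/
def val (y : Mfd.ofLocalCharts X S d hS) : ∀ e, X e := Subtype.val (p := (· ∈ S)) y

theorem val_mem (y : Mfd.ofLocalCharts X S d hS) : val hS y ∈ S := Subtype.property (p := (· ∈ S)) y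

theorem val_injective : Function.Injective (val hS) := Subtype.val_injective

theorem contMDiff_val (e : ι) :
    ContMDiff (𝓡 (Mfd.ofLocalCharts X S d hS).dim) (𝓡 (X e).dim) ∞
      (fun y : Mfd.ofLocalCharts X S d hS ↦ val hS y e) := by
  intro y
  set χ := (hS y).choose
  let φ : OpenPartialHomeomorph (Mfd.ofLocalCharts X S d hS)
      (EuclideanSpace ℝ (Fin (Mfd.ofLocalCharts X S d hS).dim)) :=
    chartAt (EuclideanSpace ℝ (Fin (Mfd.ofLocalCharts X S d hS).dim)) y
  have hφ : ContMDiffAt (𝓡 (Mfd.ofLocalCharts X S d hS).dim)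
      (𝓡 (Mfd.ofLocalCharts X S d hS).dim) ∞ φ y :=
    contMDiffAt_of_mem_maximalAtlas (IsManifold.chart_mem_maximalAtlas y) (mem_chart_source _ y)
  have h₁ : ContMDiffAt (𝓡 (Mfd.ofLocalCharts X S d hS).dim) (𝓡 (X e).dim) ∞
      (fun t : EuclideanSpace ℝ (Fin (Mfd.ofLocalCharts X S d hS).dim) ↦ χ.param t e) (φ y) :=
    (χ.contMDiffOn_param e).contMDiffAt
      (χ.isOpen_target.mem_nhds (φ.map_source (mem_chart_source _ y)))
  refine (h₁.comp y hφ).congr_of_eventuallyEq ?_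
  filter_upwards [φ.open_source.mem_nhds (mem_chart_source _ y)] with y' hy'
  exact (congrFun (χ.param_proj (val_mem hS y') hy') e).symm

/-- Coordinates extend smoothly to the ambient product, so smoothness can be tested on components
once continuity is known from the subspace topology. This yields the universal property of the
limit. -/
theorem contMDiff_of_val {a : ℕ} {Z : Type*} [TopologicalSpace Z]
    [ChartedSpace (EuclideanSpace ℝ (Fin a)) Z] {f : Z → Mfd.ofLocalCharts X S d hS}
    (hf : ∀ e, ContMDiff (𝓡 a) (𝓡 (X e).dim) ∞ (fun z ↦ val hS (f z) e)) :
    ContMDiff (𝓡 a) (𝓡 (Mfd.ofLocalCharts X S d hS).dim) ∞ f := by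
  have hc : Continuous f := by
    have h : Continuous (fun z ↦ val hS (f z)) := continuous_pi fun e ↦ (hf e).continuous
    exact Topology.IsInducing.subtypeVal.continuous_iff.2 h
  intro z
  set χ := (hS (f z)).choose
  let φ : OpenPartialHomeomorph (Mfd.ofLocalCharts X S d hS)
      (EuclideanSpace ℝ (Fin (Mfd.ofLocalCharts X S d hS).dim)) :=
    chartAt (EuclideanSpace ℝ (Fin (Mfd.ofLocalCharts X S d hS).dim)) (f z)
  have hz : f z ∈ φ.source := mem_chart_source _ (f z)
  have hφ : ContMDiffAt (𝓡 (Mfd.ofLocalCharts X S d hS).dim)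
      (𝓡 (Mfd.ofLocalCharts X S d hS).dim) ∞ φ.symm (φ (f z)) :=
    contMDiffAt_symm_of_mem_maximalAtlas (IsManifold.chart_mem_maximalAtlas (f z))
      (φ.map_source hz)
  have h₁ : ContMDiffAt (𝓡 a) (𝓡 (Mfd.ofLocalCharts X S d hS).dim) ∞ (fun z ↦ φ (f z)) z :=
    χ.contMDiffAt_coord (g := fun z ↦ val hS (f z)) (fun e ↦ hf e z) hz
  refine (hφ.comp z h₁).congr_of_eventuallyEq ?_
  filter_upwards [hc.continuousAt.preimage_mem_nhds (φ.open_source.mem_nhds hz)] with z' hz'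
  exact (φ.left_inv hz').symm

end Mfd.ofLocalCharts

end OfLocalCharts

/-! ### Derivatives, and openness of their surjectivity -/

namespace Mfd

/-- The derivative of a smooth map at a point. -/
noncomputable def deriv {M N : Mfd.{u}} (f : M ⟶ N) (x : M) :
    EuclideanSpace ℝ (Fin M.dim) →L[ℝ] EuclideanSpace ℝ (Fin N.dim) :=
  mfderiv (𝓡 M.dim) (𝓡 N.dim) (Hom.toFun f) x

theorem hasMFDerivAt {M N : Mfd.{u}} (f : M ⟶ N) (x : M) :
    HasMFDerivAt (𝓡 M.dim) (𝓡 N.dim) (Hom.toFun f) x (deriv f x) :=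
  ((Hom.contMDiff f x).mdifferentiableAt (by simp)).hasMFDerivAt

theorem deriv_id (M : Mfd.{u}) (x : M) : deriv (𝟙 M) x = ContinuousLinearMap.id ℝ _ :=
  mfderiv_id

theorem deriv_comp {M N P : Mfd.{u}} (f : M ⟶ N) (g : N ⟶ P) (x : M) :
    deriv (f ≫ g) x = (deriv g (Hom.toFun f x)).comp (deriv f x) :=
  ((hasMFDerivAt g (Hom.toFun f x)).comp x (hasMFDerivAt f x)).mfderiv

end Mfd

/-- A right inverse of the derivative at `p` is held fixed; its composite with the nearby
derivatives in the chart stays invertible. -/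
theorem eventually_surjective_mfderiv {a d : ℕ} {M : Type*} [TopologicalSpace M]
    [ChartedSpace (EuclideanSpace ℝ (Fin a)) M] [IsManifold (𝓡 a) ∞ M]
    {h : M → EuclideanSpace ℝ (Fin d)} {p : M}
    (hh : ∀ᶠ x in 𝓝 p, ContMDiffAt (𝓡 a) (𝓡 d) ∞ h x)
    (hp : Function.Surjective (mfderiv (𝓡 a) (𝓡 d) h p)) :
    ∀ᶠ x in 𝓝 p, Function.Surjective (mfderiv (𝓡 a) (𝓡 d) h x) := by
  set φ := chartAt (EuclideanSpace ℝ (Fin a)) p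
  have hpφ : p ∈ φ.source := mem_chart_source _ p
  let L : EuclideanSpace ℝ (Fin a) →L[ℝ] EuclideanSpace ℝ (Fin d) := mfderiv (𝓡 a) (𝓡 d) h p
  have hL : HasFDerivAt (fun z ↦ h (φ.symm z)) L (φ p) := HasMFDerivAt.hasFDerivAt_chart rfl
    (hh.self_of_nhds.mdifferentiableAt (by simp)).hasMFDerivAt
  have hs : ∀ᶠ z in 𝓝 (φ p), ContDiffAt ℝ ∞ (fun z ↦ h (φ.symm z)) z :=
    eventually_contDiffAt_chart rfl hh
  obtain ⟨R, hR⟩ := L.exists_rightInverse_of_surjective (LinearMap.range_eq_top.2 hp)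
  have hcont : ContinuousAt (fun z ↦ (fderiv ℝ (fun z ↦ h (φ.symm z)) z).comp R) (φ p) :=
    (hs.self_of_nhds.continuousAt_fderiv (by simp)).clm_comp continuousAt_const
  have hunit : ∀ᶠ z in 𝓝 (φ p), (fderiv ℝ (fun z ↦ h (φ.symm z)) z).comp R ∈ Set.range
      (ContinuousLinearEquiv.toContinuousLinearMap :
        (EuclideanSpace ℝ (Fin d) ≃L[ℝ] EuclideanSpace ℝ (Fin d)) → _) := by
    refine hcont.preimage_mem_nhds (ContinuousLinearEquiv.isOpen.mem_nhds
      ⟨ContinuousLinearEquiv.refl ℝ _, ?_⟩)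
    rw [hL.fderiv, hR]
    rfl
  filter_upwards [(φ.continuousAt hpφ).eventually hunit, hh, φ.open_source.mem_nhds hpφ]
    with x hx hhx hxs
  obtain ⟨e, he⟩ := hx
  have hφ : MDifferentiableAt (𝓡 a) (𝓡 a) φ.symm (φ x) :=
    (contMDiffAt_symm_of_mem_maximalAtlas (IsManifold.chart_mem_maximalAtlas p)
      (φ.map_source hxs) : ContMDiffAt (𝓡 a) (𝓡 a) ∞ φ.symm (φ x)).mdifferentiableAt (by simp)
  have h₁ : HasMFDerivAt (𝓡 a) (𝓡 d) h (φ.symm (φ x)) (mfderiv (𝓡 a) (𝓡 d) h x) := by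
    rw [φ.left_inv hxs]
    exact (hhx.mdifferentiableAt (by simp)).hasMFDerivAt
  have h₂ := (h₁.comp (φ x) hφ.hasMFDerivAt).mfderiv
  rw [mfderiv_eq_fderiv] at h₂
  intro t
  refine ⟨mfderiv (𝓡 a) (𝓡 a) φ.symm (φ x) (R (e.symm t)), ?_⟩
  have h₃ : fderiv ℝ (fun z ↦ h (φ.symm z)) (φ x) (R (e.symm t)) = t := by
    have := DFunLike.congr_fun he (e.symm t)
    exact this.symm.trans (e.apply_symm_apply t)
  exact (DFunLike.congr_fun h₂ (R (e.symm t))).symm.trans h₃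

/-! ### Compatible families near the image of a cone -/

section Limit

variable {J : Type} [Category.{0} J] (F : J ⥤ Mfd.{u})

/-- The set of sections of a diagram of manifolds. -/
def compatibleFamilies : Set (∀ j, F.obj j) :=
  {y | ∀ ⦃j k : J⦄ (f : j ⟶ k), Mfd.Hom.toFun (F.map f) (y j) = y k}

variable {F}

/-- The family of points given by a point of a cone. -/
def coneFamily (c : Cone F) (x : c.pt) (j : J) : F.obj j := Mfd.Hom.toFun (c.π.app j) x

/-- The derivatives at a point of the legs of a cone. -/
noncomputable def coneDeriv (c : Cone F) (x : c.pt) (j : J) :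
    EuclideanSpace ℝ (Fin c.pt.dim) →L[ℝ] EuclideanSpace ℝ (Fin (F.obj j).dim) :=
  Mfd.deriv (c.π.app j) x

theorem coneFamily_map (c : Cone F) (x : c.pt) {j k : J} (f : j ⟶ k) :
    Mfd.Hom.toFun (F.map f) (coneFamily c x j) = coneFamily c x k :=
  congrFun (congrArg Mfd.Hom.toFun (c.w f)) x

theorem coneFamily_mem (c : Cone F) (x : c.pt) : coneFamily c x ∈ compatibleFamilies F :=
  fun _ _ f ↦ coneFamily_map c x f

theorem continuous_coneFamily (c : Cone F) : Continuous (coneFamily c) :=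
  continuous_pi fun j ↦ (Mfd.Hom.contMDiff (c.π.app j)).continuous

variable [Fintype J] [∀ j k : J, Finite (j ⟶ k)]

/-- If the derivative of a cone at a point is surjective onto the limit of the tangent spaces, then
the set of sections of the diagram is a submanifold around the image of this point. -/
theorem exists_localChart (c : Cone F) (p : c.pt)
    (hex : ∀ v : ∀ j, EuclideanSpace ℝ (Fin (F.obj j).dim),
      (∀ ⦃j k : J⦄ (f : j ⟶ k), Mfd.deriv (F.map f) (coneFamily c p j) (v j) = v k) →
        ∃ w, ∀ j, coneDeriv c p j w = v j)
    {d : ℕ} (hd : Module.finrank ℝ (LinearMap.range (LinearMap.pi fun j ↦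
      (coneDeriv c p j).toLinearMap)) = d) :
    ∃ χ : LocalChart F.obj (compatibleFamilies F) d, coneFamily c p ∈ χ.dom ∧
      Function.Surjective (mfderiv (𝓡 c.pt.dim) (𝓡 d)
        (fun x ↦ χ.coord (coneFamily c x)) p) := by
  classical
  let φ := chartAt (EuclideanSpace ℝ (Fin c.pt.dim)) p
  let ch : ∀ j, OpenPartialHomeomorph (F.obj j) (EuclideanSpace ℝ (Fin (F.obj j).dim)) :=
    fun j ↦ chartAt _ (coneFamily c p j)
  have hpφ : p ∈ φ.source := mem_chart_source _ p
  have hch : ∀ j, coneFamily c p j ∈ (ch j).source := fun j ↦ mem_chart_source _ _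
  have hchm : ∀ j, ch j ∈ IsManifold.maximalAtlas (𝓡 (F.obj j).dim) ∞ (F.obj j) :=
    fun j ↦ IsManifold.chart_mem_maximalAtlas _
  have hφs : Tendsto φ.symm (𝓝 (φ p)) (𝓝 p) := by
    have := φ.continuousAt_symm (φ.map_source hpφ)
    rwa [ContinuousAt, φ.left_inv hpφ] at this
  have hDs : ∀ᶠ x in 𝓝 p, ∀ j, coneFamily c x j ∈ (ch j).source :=
    eventually_all.2 fun j ↦ ((continuous_apply j).comp
      (continuous_coneFamily c)).continuousAt.preimage_mem_nhds
        ((ch j).open_source.mem_nhds (hch j))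
  let R := Σ j k : J, (j ⟶ k)
  have : Finite R := inferInstance
  have : Fintype R := Fintype.ofFinite R
  let D : EuclideanSpace ℝ (Fin c.pt.dim) → ∀ j, EuclideanSpace ℝ (Fin (F.obj j).dim) :=
    fun z j ↦ ch j (coneFamily c (φ.symm z) j)
  -- One compatibility equation per morphism, read in charts. The kernel of the derivative is the
  -- limit of the tangent spaces, so `hex` is the exactness required for the parametrization.
  let A : (∀ j, EuclideanSpace ℝ (Fin (F.obj j).dim)) →
      ∀ r : R, EuclideanSpace ℝ (Fin (F.obj r.2.1).dim) :=
    fun v r ↦ ch r.2.1 (Mfd.Hom.toFun (F.map r.2.2) ((ch r.1).symm (v r.1))) - v r.2.1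
  have hDp : D (φ p) = fun j ↦ ch j (coneFamily c p j) := by
    funext j
    simp only [D]
    rw [φ.left_inv hpφ]
  have hD : ∀ᶠ z in 𝓝 (φ p), ContDiffAt ℝ ∞ D z := by
    have : ∀ᶠ z in 𝓝 (φ p), ∀ j, ContDiffAt ℝ ∞ (fun z ↦ D z j) z := eventually_all.2 fun j ↦
      eventually_contDiffAt_chart (M := c.pt) (a := c.pt.dim) (f := Mfd.Hom.toFun (c.π.app j))
        (x := p) rfl
        (Eventually.of_forall fun x ↦ Mfd.Hom.contMDiff (c.π.app j) x)
    filter_upwards [this] with z hz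
    exact contDiffAt_pi.2 hz
  let D' : EuclideanSpace ℝ (Fin c.pt.dim) →L[ℝ] ∀ j, EuclideanSpace ℝ (Fin (F.obj j).dim) :=
    ContinuousLinearMap.pi fun j ↦ coneDeriv c p j
  have hD' : HasFDerivAt D D' (φ p) := hasFDerivAt_pi.2 fun j ↦
    HasMFDerivAt.hasFDerivAt_chart rfl (Mfd.hasMFDerivAt (c.π.app j) p)
  let A' : (∀ j, EuclideanSpace ℝ (Fin (F.obj j).dim)) →L[ℝ]
      ∀ r : R, EuclideanSpace ℝ (Fin (F.obj r.2.1).dim) :=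
    ContinuousLinearMap.pi fun r ↦
      (Mfd.deriv (F.map r.2.2) (coneFamily c p r.1)).comp (ContinuousLinearMap.proj (R := ℝ)
        (φ := fun j ↦ EuclideanSpace ℝ (Fin (F.obj j).dim)) r.1) -
        ContinuousLinearMap.proj (R := ℝ)
          (φ := fun j ↦ EuclideanSpace ℝ (Fin (F.obj j).dim)) r.2.1
  have hproj : ∀ (v : ∀ j, EuclideanSpace ℝ (Fin (F.obj j).dim)) (j : J),
      ContDiffAt ℝ ∞ (fun v : (∀ j, EuclideanSpace ℝ (Fin (F.obj j).dim)) ↦ v j) v :=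
    fun v ↦ contDiffAt_pi.1 contDiffAt_id
  have hA : ContDiffAt ℝ ∞ A (D (φ p)) := by
    refine contDiffAt_pi.2 fun r ↦ ContDiffAt.sub ?_ (hproj _ _)
    have h₁ := (eventually_contDiffAt_chart (f := Mfd.Hom.toFun (F.map r.2.2))
      (x := coneFamily c p r.1) (coneFamily_map c p r.2.2)
        (Eventually.of_forall fun x ↦ Mfd.Hom.contMDiff (F.map r.2.2) x)).self_of_nhds
    rw [hDp]
    exact ContDiffAt.comp (g := fun z ↦ ch r.2.1 (Mfd.Hom.toFun (F.map r.2.2) ((ch r.1).symm z)))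
      (f := fun v : (∀ j, EuclideanSpace ℝ (Fin (F.obj j).dim)) ↦ v r.1) _ h₁
      (hproj _ _)
  have hA' : HasFDerivAt A A' (D (φ p)) := by
    refine hasFDerivAt_pi.2 fun r ↦ HasFDerivAt.sub ?_ (hasFDerivAt_apply _ _)
    have h₁ := HasMFDerivAt.hasFDerivAt_chart (coneFamily_map c p r.2.2)
      (Mfd.hasMFDerivAt (F.map r.2.2) (coneFamily c p r.1))
    rw [hDp]
    exact HasFDerivAt.comp (g := fun z ↦ ch r.2.1 (Mfd.Hom.toFun (F.map r.2.2) ((ch r.1).symm z)))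
      (f := fun v : (∀ j, EuclideanSpace ℝ (Fin (F.obj j).dim)) ↦ v r.1) _ h₁
      (hasFDerivAt_apply _ _)
  have hAD : ∀ᶠ z in 𝓝 (φ p), A (D z) = 0 := by
    filter_upwards [hφs.eventually hDs] with z hz
    funext r
    simp only [A, D]
    rw [(ch r.1).left_inv (hz r.1), coneFamily_map, sub_self]
    rfl
  obtain ⟨π, τ, hτ, hτp, hπτ, hτπ, hsurj⟩ := exists_local_parametrization hD hD' hA hA' hAD
    (by
      intro v hv
      obtain ⟨w, hw⟩ := hex v fun j k f ↦ sub_eq_zero.1 (congrFun hv ⟨j, k, f⟩)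
      exact ⟨w, funext hw⟩) hd
  obtain ⟨N, hN, hNo, hpN⟩ := eventually_nhds_iff.1 hτπ
  have hτc : Tendsto τ (𝓝 (π (D (φ p)))) (𝓝 (φ p)) := by
    have := hτ.self_of_nhds.continuousAt
    rwa [ContinuousAt, hτp] at this
  obtain ⟨T, hT, hTo, hpT⟩ := eventually_nhds_iff.1 <| hτ.and <| hπτ.and <|
    (hτc.eventually (φ.open_target.mem_nhds (φ.map_source hpφ))).and <|
    ((hφs.comp hτc).eventually hDs).and <|
    (hD.self_of_nhds.continuousAt.tendsto.comp hτc).eventually (hNo.mem_nhds hpN)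
  let χ : LocalChart F.obj (compatibleFamilies F) d :=
    { chart := ch
      chart_mem := hchm
      proj := π
      -- On `N` the zeros of `A` are recovered by `D ∘ τ ∘ π`; on `T` the map `τ` is smooth, `π ∘ D
      -- ∘ τ` is the identity, and `D ∘ τ` lands in `N`.
      dom := {y | ∀ j, y j ∈ (ch j).source} ∩ (fun y j ↦ ch j (y j)) ⁻¹' (N ∩ π ⁻¹' T)
      isOpen_dom := by
        refine ContinuousOn.isOpen_inter_preimage ?_ ?_
          (hNo.inter (hTo.preimage π.continuous))
        · exact continuousOn_pi.2 fun j ↦ (ch j).continuousOn.comp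
            (continuous_apply j).continuousOn fun y hy ↦ hy j
        · simp only [ofPred_forall]
          exact isOpen_iInter_of_finite fun j ↦ (ch j).open_source.preimage (continuous_apply j)
      mem_source := fun hy j ↦ hy.1 j
      target := T
      isOpen_target := hTo
      -- Parametrizing through the cone makes compatibility automatic, so zeros of `A` need not be
      -- shown compatible.
      param := fun t ↦ coneFamily c (φ.symm (τ t))
      contMDiffOn_param := fun j t ht ↦ by
        have h₁ : ContMDiffAt (𝓡 d) (𝓡 c.pt.dim) ∞ τ t := (hT t ht).1.contMDiffAt
        have h₂ : ContMDiffAt (𝓡 c.pt.dim) (𝓡 c.pt.dim) ∞ φ.symm (τ t) :=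
          contMDiffAt_symm_of_mem_maximalAtlas (IsManifold.chart_mem_maximalAtlas p)
            (hT t ht).2.2.1
        exact ((Mfd.Hom.contMDiff (c.π.app j) _).comp t (h₂.comp t h₁)).contMDiffWithinAt
      param_mem := fun _ ↦ coneFamily_mem c _
      param_mem_dom := fun {t} ht ↦ ⟨(hT t ht).2.2.2.1, (hT t ht).2.2.2.2, by
        rw [mem_preimage]
        exact (hT t ht).2.1.symm ▸ ht⟩
      proj_param := fun {t} ht ↦ (hT t ht).2.1
      proj_mem := fun _ hy' ↦ hy'.2.2
      param_proj := fun {y} hy hy' ↦ by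
        have h₁ : A (fun j ↦ ch j (y j)) = 0 := by
          funext r
          simp only [A]
          rw [(ch r.1).left_inv (hy'.1 r.1), hy, sub_self]
          rfl
        have h₂ := hN _ hy'.2.1 h₁
        funext j
        exact (ch j).injOn ((hT _ hy'.2.2).2.2.2.1 j) (hy'.1 j) (congrFun h₂ j) }
  have hdom : coneFamily c p ∈ χ.dom := by
    refine ⟨hch, ?_⟩
    rw [hDp] at hpN hpT
    exact ⟨hpN, hpT⟩
  refine ⟨χ, hdom, ?_⟩
  have hcont : ContMDiffAt (𝓡 c.pt.dim) (𝓡 d) ∞ (fun x ↦ χ.coord (coneFamily c x)) p :=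
    χ.contMDiffAt_coord (fun j ↦ Mfd.Hom.contMDiff (c.π.app j) p) hdom
  have h₁ : HasMFDerivAt (𝓡 c.pt.dim) (𝓡 d) (fun x ↦ χ.coord (coneFamily c x)) p
      (π.comp D') :=
    ⟨hcont.continuousAt, (π.hasFDerivAt.comp (φ p) hD').hasFDerivWithinAt⟩
  rw [h₁.mfderiv]
  exact hsurj

end Limit

/-! ### Limits of diagrams of open submanifolds -/

section Restrict

variable {J : Type} [Category.{0} J] (F : J ⥤ Mfd.{u})

/-- The diagram of open submanifolds given by open subsets preserved by the transition maps. -/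
noncomputable def restrictFunctor (U : ∀ j, TopologicalSpace.Opens (F.obj j))
    (hU : ∀ ⦃j k : J⦄ (f : j ⟶ k), ∀ x ∈ U j, Mfd.Hom.toFun (F.map f) x ∈ U k) : J ⥤ Mfd.{u} where
  obj j := (F.obj j).ofOpens (U j)
  map {j k} f := Mfd.restrict (F.map f) (U j) (U k) (hU f)
  map_id j := by
    apply Mfd.Hom.ext
    funext x
    apply Subtype.ext
    change Mfd.Hom.toFun (F.map (𝟙 j)) x.1 = x.1
    rw [CategoryTheory.Functor.map_id]
    rfl
  map_comp {j k l} f g := by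
    apply Mfd.Hom.ext
    funext x
    apply Subtype.ext
    change Mfd.Hom.toFun (F.map (f ≫ g)) x.1 = _
    rw [CategoryTheory.Functor.map_comp]
    rfl

variable {F} {U : ∀ j, TopologicalSpace.Opens (F.obj j)}
  {hU : ∀ ⦃j k : J⦄ (f : j ⟶ k), ∀ x ∈ U j, Mfd.Hom.toFun (F.map f) x ∈ U k}

/-- The family of points of the ambient manifolds given by a point of a cone over a diagram of open
submanifolds. -/
noncomputable def restrictFamily (s : Cone (restrictFunctor F U hU)) (x : s.pt) (j : J) : F.obj j :=
  Subtype.val (p := (· ∈ U j)) (coneFamily s x j)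

theorem restrictFamily_mem (s : Cone (restrictFunctor F U hU)) (x : s.pt) :
    restrictFamily s x ∈ compatibleFamilies F :=
  fun _ _ f ↦ congrArg Subtype.val (coneFamily_map s x f)

theorem restrictFamily_mem_opens (s : Cone (restrictFunctor F U hU)) (x : s.pt) (j : J) :
    restrictFamily s x j ∈ U j :=
  Subtype.property (p := (· ∈ U j)) (coneFamily s x j)

theorem contMDiff_restrictFamily (s : Cone (restrictFunctor F U hU)) (j : J) :
    ContMDiff (𝓡 s.pt.dim) (𝓡 (F.obj j).dim) ∞ (fun x ↦ restrictFamily s x j) :=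
  (contMDiff_subtype_val (U := U j)).comp (Mfd.Hom.contMDiff (M := s.pt) (s.π.app j))

/-- A diagram of open submanifolds has a limit if its set of sections is covered by local charts,
and a criterion for a map to this limit to be a submersion. -/
theorem exists_isLimit_restrictFunctor [Fintype J] {d : ℕ}
    (hloc : ∀ y ∈ compatibleFamilies F, (∀ j, y j ∈ U j) →
      ∃ χ : LocalChart F.obj (compatibleFamilies F) d, y ∈ χ.dom) :
    ∃ (L : Cone (restrictFunctor F U hU)) (hL : IsLimit L),
      ∀ s : Cone (restrictFunctor F U hU),
        (∀ x : s.pt, ∃ χ : LocalChart F.obj (compatibleFamilies F) d,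
          restrictFamily s x ∈ χ.dom ∧ Function.Surjective (mfderiv (𝓡 s.pt.dim) (𝓡 d)
            (fun x ↦ χ.coord (restrictFamily s x)) x)) →
        Mfd.submersions (hL.lift s) := by
  let Ω : Set (∀ j, F.obj j) := {y | ∀ j, y j ∈ U j}
  have hΩ : IsOpen Ω := by
    simp only [Ω, ofPred_forall]
    exact isOpen_iInter_of_finite fun j ↦ (U j).isOpen.preimage (continuous_apply j)
  have hS : ∀ y : ↥(compatibleFamilies F ∩ Ω),
      ∃ χ : LocalChart F.obj (compatibleFamilies F ∩ Ω) d, y.1 ∈ χ.dom := fun y ↦ by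
    obtain ⟨χ, hχ⟩ := hloc y.1 y.2.1 y.2.2
    exact ⟨χ.restrict Ω hΩ, hχ⟩
  let M := Mfd.ofLocalCharts F.obj (compatibleFamilies F ∩ Ω) d hS
  let leg : ∀ j, M ⟶ (restrictFunctor F U hU).obj j := fun j ↦
    Mfd.Hom.mk (M := M) (N := (F.obj j).ofOpens (U j))
      (fun y ↦ ⟨Mfd.ofLocalCharts.val hS y j, (Mfd.ofLocalCharts.val_mem hS y).2 j⟩)
      ((ContMDiff.subtypeVal_comp_iff (I := 𝓡 M.dim) (I' := 𝓡 (F.obj j).dim) (U j) _).1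
        (Mfd.ofLocalCharts.contMDiff_val hS j))
  let L : Cone (restrictFunctor F U hU) :=
    { pt := M
      π :=
        { app := leg
          naturality := fun j k f ↦ by
            apply Mfd.Hom.ext
            funext y
            apply Subtype.ext
            exact ((Mfd.ofLocalCharts.val_mem hS y).1 f).symm } }
  let lift : ∀ s : Cone (restrictFunctor F U hU), s.pt ⟶ M := fun s ↦
    Mfd.Hom.mk (M := s.pt) (N := M)
      (fun x ↦ (⟨restrictFamily s x, restrictFamily_mem s x, restrictFamily_mem_opens s x⟩ :
        ↥(compatibleFamilies F ∩ Ω)))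
      (Mfd.ofLocalCharts.contMDiff_of_val hS fun j ↦ contMDiff_restrictFamily s j)
  let hL : IsLimit L :=
    { lift := lift
      fac := fun s j ↦ rfl
      uniq := fun s m hm ↦ by
        apply Mfd.Hom.ext
        funext x
        apply Subtype.ext
        funext j
        exact congrArg Subtype.val (congrFun (congrArg Mfd.Hom.toFun (hm j)) x) }
  refine ⟨L, hL, fun s hs ↦ ?_⟩
  refine Manifold.IsSubmersionOfComplement.isSubmersion
    (F := EuclideanSpace ℝ (Fin (s.pt.dim - M.dim))) fun x ↦ ?_
  refine isSubmersionAtOfComplement_of_surjective_mfderiv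
    (Eventually.of_forall fun y ↦ Mfd.Hom.contMDiff (lift s) y) ?_
  obtain ⟨χ, hχ, hsurj⟩ := hs x
  have h₁ : ContMDiffAt (𝓡 M.dim) (𝓡 d) ∞ (fun y ↦ χ.coord (Mfd.ofLocalCharts.val hS y))
      (Mfd.Hom.toFun (lift s) x) :=
    χ.contMDiffAt_coord (fun j ↦ Mfd.ofLocalCharts.contMDiff_val hS j _) hχ
  let g : EuclideanSpace ℝ (Fin d) →L[ℝ] EuclideanSpace ℝ (Fin d) :=
    mfderiv (𝓡 M.dim) (𝓡 d) (fun y ↦ χ.coord (Mfd.ofLocalCharts.val hS y))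
      (Mfd.Hom.toFun (lift s) x)
  let l : EuclideanSpace ℝ (Fin s.pt.dim) →L[ℝ] EuclideanSpace ℝ (Fin d) :=
    Mfd.deriv (lift s) x
  have h₂ : mfderiv (𝓡 s.pt.dim) (𝓡 d) (fun x ↦ χ.coord (restrictFamily s x)) x = g.comp l :=
    ((h₁.mdifferentiableAt (by simp)).hasMFDerivAt.comp x
      (Mfd.hasMFDerivAt (lift s) x)).mfderiv
  rw [h₂] at hsurj
  have hg : Function.Surjective g := Function.Surjective.of_comp hsurj
  -- Source and target of `g` both have dimension `d`, so `g` is bijective and can be cancelled from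
  -- the surjective composite.
  have hgi : Function.Injective g :=
    (LinearMap.injective_iff_surjective (f := g.toLinearMap)).2 hg
  intro t
  obtain ⟨v, hv⟩ := hsurj (g t)
  exact ⟨v, hgi hv⟩

variable [Fintype J] [∀ j k : J, Finite (j ⟶ k)]

theorem eventually_exists_localChart (c : Cone F) (p : c.pt)
    (hex : ∀ v : ∀ j, EuclideanSpace ℝ (Fin (F.obj j).dim),
      (∀ ⦃j k : J⦄ (f : j ⟶ k), Mfd.deriv (F.map f) (coneFamily c p j) (v j) = v k) →
        ∃ w, ∀ j, coneDeriv c p j w = v j)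
    {d : ℕ} (hd : Module.finrank ℝ (LinearMap.range (LinearMap.pi fun j ↦
      (coneDeriv c p j).toLinearMap)) = d) :
    ∀ᶠ x in 𝓝 p, ∃ χ : LocalChart F.obj (compatibleFamilies F) d, coneFamily c x ∈ χ.dom ∧
      Function.Surjective (mfderiv (𝓡 c.pt.dim) (𝓡 d) (fun x ↦ χ.coord (coneFamily c x)) x) := by
  obtain ⟨χ, hχ, hsurj⟩ := exists_localChart c p hex hd
  have h₁ : ∀ᶠ x in 𝓝 p, coneFamily c x ∈ χ.dom :=
    (continuous_coneFamily c).continuousAt.preimage_mem_nhds (χ.isOpen_dom.mem_nhds hχ)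
  have h₂ : ∀ᶠ x in 𝓝 p,
      ContMDiffAt (𝓡 c.pt.dim) (𝓡 d) ∞ (fun x ↦ χ.coord (coneFamily c x)) x := by
    filter_upwards [h₁] with x hx
    exact χ.contMDiffAt_coord (fun j ↦ Mfd.Hom.contMDiff (M := c.pt) (c.π.app j) x) hx
  filter_upwards [h₁, eventually_surjective_mfderiv h₂ hsurj] with x hx hx'
  exact ⟨χ, hx, hx'⟩

/-- Near `x` the map `h` factors through its restriction to `V` by a local inverse of the inclusion,
so the restriction has at least as large a derivative image. -/
theorem surjective_mfderiv_comp_val {M : Mfd.{u}} {d : ℕ} (V : TopologicalSpace.Opens M)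
    {h : M → EuclideanSpace ℝ (Fin d)} (x : V)
    (hh : MDifferentiableAt (𝓡 M.dim) (𝓡 d) h x.1)
    (hs : Function.Surjective (mfderiv (𝓡 M.dim) (𝓡 d) h x.1)) :
    Function.Surjective (mfderiv (𝓡 M.dim) (𝓡 d) (fun y : V ↦ h y.1) x) := by
  classical
  let r : M → V := fun y ↦ if hy : y ∈ V then ⟨y, hy⟩ else x
  have hV : ∀ᶠ y in 𝓝 x.1, y ∈ V := V.isOpen.mem_nhds x.2
  have hr : ∀ᶠ y in 𝓝 x.1, (r y).1 = y := by
    filter_upwards [hV] with y hy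
    simp only [r, dif_pos hy]
  have hrx : r x.1 = x := by simp [r]
  have h₁ : MDifferentiableAt (𝓡 M.dim) (𝓡 M.dim) r x.1 := by
    have : ContMDiffAt (𝓡 M.dim) (𝓡 M.dim) ∞ r x.1 :=
      (ContMDiffAt.subtypeVal_comp_iff (I := 𝓡 M.dim) (I' := 𝓡 M.dim) V r x.1).1
        (contMDiffAt_id.congr_of_eventuallyEq hr)
    exact this.mdifferentiableAt (by simp)
  have h₂ : MDifferentiableAt (𝓡 M.dim) (𝓡 d) (fun y : V ↦ h y.1) (r x.1) := by
    rw [hrx]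
    exact hh.comp x ((contMDiff_subtype_val (I := 𝓡 M.dim) (n := ∞) (U := V)
      x).mdifferentiableAt (by simp))
  have h₃ : HasMFDerivAt (𝓡 M.dim) (𝓡 d) h x.1 _ :=
    (h₂.hasMFDerivAt.comp x.1 h₁.hasMFDerivAt).congr_of_eventuallyEq (by
      filter_upwards [hr] with y hy
      simp only [Function.comp_apply, hy])
  rw [h₃.mfderiv] at hs
  have h₄ : Function.Surjective (mfderiv (𝓡 M.dim) (𝓡 d) (fun y : V ↦ h y.1) (r x.1)) :=
    fun t ↦ let ⟨_, hv⟩ := hs t; ⟨_, hv⟩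
  rwa [hrx] at h₄

end Restrict

/-! ### Simplicial vector spaces: Moore subspaces and fillers -/

/-- A simplicial vector space, with faces and degeneracies indexed by natural numbers (they are only
constrained in the relevant range). -/
structure SimplicialVectorSpace (V : ℕ → Type*) [∀ m, AddCommGroup (V m)]
    [∀ m, Module ℝ (V m)] where
  d (m : ℕ) (i : ℕ) : V (m + 1) →ₗ[ℝ] V m
  s (m : ℕ) (i : ℕ) : V m →ₗ[ℝ] V (m + 1)
  d_d {m i j : ℕ} (hij : i ≤ j) (hj : j ≤ m + 1) (x : V (m + 2)) :
    d m i (d (m + 1) (j + 1) x) = d m j (d (m + 1) i x)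
  d_s_self {m i : ℕ} (hi : i ≤ m) (x : V m) : d m i (s m i x) = x
  d_s_succ {m i : ℕ} (hi : i ≤ m) (x : V m) : d m (i + 1) (s m i x) = x
  d_s_of_le {m i j : ℕ} (hij : i ≤ j) (hj : j ≤ m) (x : V (m + 1)) :
    d (m + 1) i (s (m + 1) (j + 1) x) = s m j (d m i x)
  d_s_of_lt {m i j : ℕ} (hij : j < i) (hi : i ≤ m + 1) (x : V (m + 1)) :
    d (m + 1) (i + 1) (s (m + 1) j x) = s m j (d m i x)

namespace SimplicialVectorSpace

variable {V : ℕ → Type*} [∀ m, AddCommGroup (V m)] [∀ m, Module ℝ (V m)]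
  (T : SimplicialVectorSpace V)

/-- The subspace of the simplices whose first `p` and last `q` faces vanish. -/
def moore (m p q : ℕ) : Submodule ℝ (V m) :=
  match m with
  | 0 => ⊤
  | m + 1 => ⨅ l : {l : ℕ // l ≤ m + 1 ∧ (l < p ∨ m + 1 < l + q)}, LinearMap.ker (T.d m l)

theorem mem_moore_succ {m p q : ℕ} {x : V (m + 1)} :
    x ∈ T.moore (m + 1) p q ↔ ∀ l ≤ m + 1, (l < p ∨ m + 1 < l + q) → T.d m l x = 0 := by
  simp [moore, Submodule.mem_iInf]

theorem moore_zero_zero (m : ℕ) : T.moore m 0 0 = ⊤ := by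
  cases m with
  | zero => rfl
  | succ m =>
    rw [eq_top_iff]
    intro x _
    rw [mem_moore_succ]
    intro l hl h
    omega

theorem d_mem_moore {m p q : ℕ} (h : p + q ≤ m) {x : V (m + 1)} (hx : x ∈ T.moore (m + 1) p q)
    {k : ℕ} (hk : p ≤ k) (hk' : k + q ≤ m + 1) : T.d m k x ∈ T.moore m p q := by
  cases m with
  | zero => trivial
  | succ m =>
    rw [mem_moore_succ] at hx ⊢
    rintro l hl (h₁ | h₁)
    · obtain ⟨k, rfl⟩ : ∃ k', k = k' + 1 := ⟨k - 1, by omega⟩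
      rw [T.d_d (by omega) (by omega), hx l (by omega) (Or.inl h₁), map_zero]
    · rw [← T.d_d (by omega) (by omega), hx (l + 1) (by omega) (Or.inr (by omega)), map_zero]

/-- The degeneracy `s_p` splits `d_p`. The faces required to vanish pass through it to faces that
vanish on `z`. -/
theorem exists_mem_moore_left {m p q : ℕ} (h : p + q ≤ m) {z : V m} (hz : z ∈ T.moore m p q) :
    ∃ x ∈ T.moore (m + 1) p q, T.d m p x = z := by
  refine ⟨T.s m p z, ?_, T.d_s_self (by omega) z⟩
  rw [mem_moore_succ]
  cases m with
  | zero => intro l hl h'; omega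
  | succ m =>
    rw [mem_moore_succ] at hz
    rintro l hl (h₁ | h₁)
    · obtain ⟨p, rfl⟩ : ∃ p', p = p' + 1 := ⟨p - 1, by omega⟩
      rw [T.d_s_of_le (by omega) (by omega), hz l (by omega) (Or.inl (by omega)), map_zero]
    · obtain ⟨l, rfl⟩ : ∃ l', l = l' + 1 := ⟨l - 1, by omega⟩
      rw [T.d_s_of_lt (by omega) (by omega), hz l (by omega) (Or.inr (by omega)), map_zero]

theorem exists_mem_moore_right {m p q : ℕ} (h : p + q ≤ m) {z : V m} (hz : z ∈ T.moore m p q) :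
    ∃ x ∈ T.moore (m + 1) p q, T.d m (m + 1 - q) x = z := by
  obtain ⟨k, hk⟩ : ∃ k, m = k + q := ⟨m - q, by omega⟩
  rw [show m + 1 - q = k + 1 by omega]
  refine ⟨T.s m k z, ?_, T.d_s_succ (by omega) z⟩
  rw [mem_moore_succ]
  cases m with
  | zero => intro l hl h'; omega
  | succ m =>
    rw [mem_moore_succ] at hz
    rintro l hl (h₁ | h₁)
    · obtain ⟨k, rfl⟩ : ∃ k', k = k' + 1 := ⟨k - 1, by omega⟩
      rw [T.d_s_of_le (by omega) (by omega), hz l (by omega) (Or.inl (by omega)), map_zero]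
    · obtain ⟨l, rfl⟩ : ∃ l', l = l' + 1 := ⟨l - 1, by omega⟩
      rw [T.d_s_of_lt (by omega) (by omega), hz l (by omega) (Or.inr (by omega)), map_zero]

variable [∀ m, FiniteDimensional ℝ (V m)]

/-- Rank-nullity for `d_k` between Moore subspaces: its kernel imposes one more vanishing face. -/
theorem finrank_moore_add {m p q k p' q' : ℕ} (h : p + q ≤ m) (hk : p ≤ k) (hk' : k + q ≤ m + 1)
    (hsurj : ∀ z ∈ T.moore m p q, ∃ x ∈ T.moore (m + 1) p q, T.d m k x = z)
    (hker : ∀ x, x ∈ T.moore (m + 1) p' q' ↔ x ∈ T.moore (m + 1) p q ∧ T.d m k x = 0) :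
    Module.finrank ℝ (T.moore (m + 1) p' q') + Module.finrank ℝ (T.moore m p q) =
      Module.finrank ℝ (T.moore (m + 1) p q) := by
  let f : T.moore (m + 1) p q →ₗ[ℝ] T.moore m p q :=
    (T.d m k).restrict fun x hx ↦ T.d_mem_moore h hx hk hk'
  have hf : LinearMap.range f = ⊤ := by
    rw [LinearMap.range_eq_top]
    intro z
    obtain ⟨x, hx, hxz⟩ := hsurj z.1 z.2
    exact ⟨⟨x, hx⟩, Subtype.ext hxz⟩
  have hle : T.moore (m + 1) p' q' ≤ T.moore (m + 1) p q := fun x hx ↦ ((hker x).1 hx).1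
  have hkf : LinearMap.ker f = (T.moore (m + 1) p' q').comap (T.moore (m + 1) p q).subtype := by
    ext x
    rw [LinearMap.mem_ker, Submodule.mem_comap, Submodule.subtype_apply, hker x.1]
    exact ⟨fun hx ↦ ⟨x.2, congrArg Subtype.val hx⟩, fun hx ↦ Subtype.ext hx.2⟩
  have := LinearMap.finrank_range_add_finrank_ker f
  rw [hf, finrank_top, hkf, (Submodule.comapSubtypeEquivOfLe hle).finrank_eq] at this
  omega

/-- The dimension of the Moore subspaces in terms of the dimensions of a simplicial vector space. -/
def mooreDim (D : ℕ → ℕ) (m r : ℕ) : ℕ :=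
  match r with
  | 0 => D m
  | r + 1 => mooreDim D m r - mooreDim D (m - 1) r

/-- Only the number of vanishing faces matters, since dropping one from either end gives the same
recursion. The natural subtraction in `mooreDim` loses nothing, by `finrank_moore_add`. -/
theorem finrank_moore {D : ℕ → ℕ} (hD : ∀ m, Module.finrank ℝ (V m) = D m) {r m p q : ℕ}
    (hr : p + q = r) (hm : r ≤ m) : Module.finrank ℝ (T.moore m p q) = mooreDim D m r := by
  induction r generalizing m p q with
  | zero =>
    obtain ⟨rfl, rfl⟩ : p = 0 ∧ q = 0 := by omega
    rw [moore_zero_zero, finrank_top, hD]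
    rw [mooreDim]
  | succ r ih =>
    obtain ⟨m, rfl⟩ : ∃ m', m = m' + 1 := ⟨m - 1, by omega⟩
    rw [mooreDim, Nat.add_sub_cancel]
    by_cases hp : p = 0
    · obtain ⟨q, rfl⟩ : ∃ q', q = q' + 1 := ⟨q - 1, by omega⟩
      have := T.finrank_moore_add (m := m) (p := p) (q := q) (k := m + 1 - q) (p' := p)
        (q' := q + 1) (by omega) (by omega) (by omega)
        (fun z hz ↦ T.exists_mem_moore_right (by omega) hz) (fun x ↦ by
          simp only [mem_moore_succ]
          constructor
          · intro hx
            exact ⟨fun l hl h ↦ hx l hl (by omega), hx _ (by omega) (by omega)⟩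
          · rintro ⟨hx, hx'⟩ l hl h
            by_cases hlq : l = m + 1 - q
            · rw [hlq, hx']
            · exact hx l hl (by omega))
      rw [ih (m := m) (p := p) (q := q) (by omega) (by omega),
        ih (m := m + 1) (p := p) (q := q) (by omega) (by omega)] at this
      omega
    · obtain ⟨p, rfl⟩ : ∃ p', p = p' + 1 := ⟨p - 1, by omega⟩
      have := T.finrank_moore_add (m := m) (p := p) (q := q) (k := p) (p' := p + 1)
        (q' := q) (by omega) (by omega) (by omega)
        (fun z hz ↦ T.exists_mem_moore_left (by omega) hz) (fun x ↦ by
          simp only [mem_moore_succ]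
          constructor
          · intro hx
            exact ⟨fun l hl h ↦ hx l hl (by omega), hx _ (by omega) (by omega)⟩
          · rintro ⟨hx, hx'⟩ l hl h
            by_cases hlp : l = p
            · rw [hlp, hx']
            · exact hx l hl (by omega))
      rw [ih (m := m) (p := p) (q := q) (by omega) (by omega),
        ih (m := m + 1) (p := p) (q := q) (by omega) (by omega)] at this
      omega

omit [∀ m, FiniteDimensional ℝ (V m)] in
-- The defect of a partial filler on a new face is killed by the faces already matched: horn
-- compatibility and the simplicial identities give both terms the same value. The cast in `hy`
-- reflects that compatibility is void for `m = 0`.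
theorem exists_filler_aux {m i : ℕ} (hi : i ≤ m + 1) (y : ℕ → V m)
    (hy : ∀ m' (h : m = m' + 1) (a b : ℕ), a ≤ b → b ≤ m' + 1 → a ≠ i → b + 1 ≠ i →
      T.d m' a (h ▸ y (b + 1)) = T.d m' b (h ▸ y a)) {p q k : ℕ} (hp : p ≤ i) (hq : i + q ≤ m + 1)
    (hpq : p + q ≤ m) (hki : k ≠ i) (hk : p ≤ k) (hk' : k + q ≤ m + 1) {w : V (m + 1)}
    (hw : ∀ l ≤ m + 1, (l < p ∨ m + 1 < l + q) → T.d m l w = y l) :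
    y k - T.d m k w ∈ T.moore m p q := by
  cases m with
  | zero => trivial
  | succ m =>
    rw [mem_moore_succ]
    rintro l hl (h | h)
    · obtain ⟨k, rfl⟩ : ∃ k', k = k' + 1 := ⟨k - 1, by omega⟩
      have h₁ := hy m rfl l k (by omega) (by omega) (by omega) (by omega)
      have h₂ := T.d_d (i := l) (j := k) (by omega) (by omega) w
      rw [map_sub, h₁, h₂, hw l (by omega) (Or.inl h), sub_self]
    · have h₁ := hy m rfl k l (by omega) (by omega) (by omega) (by omega)
      have h₂ := T.d_d (i := k) (j := l) (by omega) (by omega) w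
      rw [map_sub, ← h₁, ← h₂, hw (l + 1) (by omega) (Or.inr (by omega)), sub_self]

omit [∀ m, FiniteDimensional ℝ (V m)] in
/-- Simplicial vector spaces satisfy the Kan condition. -/
theorem exists_filler {m i : ℕ} (hi : i ≤ m + 1) (y : ℕ → V m)
    (hy : ∀ m' (h : m = m' + 1) (a b : ℕ), a ≤ b → b ≤ m' + 1 → a ≠ i → b + 1 ≠ i →
      T.d m' a (h ▸ y (b + 1)) = T.d m' b (h ▸ y a)) :
    ∃ w, ∀ l ≤ m + 1, l ≠ i → T.d m l w = y l := by
  -- The faces below `i` are matched upwards, then those above `i` downwards from the last. Each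
  -- correction lies in a Moore subspace, so faces matched earlier do not change.
  have key : ∀ q, i + q ≤ m + 1 → ∀ p ≤ i,
      ∃ w, ∀ l ≤ m + 1, (l < p ∨ m + 1 < l + q) → T.d m l w = y l := by
    intro q
    induction q with
    | zero =>
      intro _ p
      induction p with
      | zero => exact fun _ ↦ ⟨0, fun l hl h ↦ by omega⟩
      | succ p ihp =>
        intro hp
        obtain ⟨w, hw⟩ := ihp (by omega)
        obtain ⟨x, hx, hxp⟩ := T.exists_mem_moore_left (by omega) (T.exists_filler_aux hi y hy
          (by omega) (by omega) (by omega) (by omega : p ≠ i) le_rfl (by omega) hw)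
        refine ⟨w + x, fun l hl h ↦ ?_⟩
        rw [map_add]
        by_cases hlp : l = p
        · rw [hlp, hxp, add_sub_cancel]
        · rw [hw l hl (by omega), T.mem_moore_succ.1 hx l hl (by omega), add_zero]
    | succ q ihq =>
      intro hq p hp
      obtain ⟨w, hw⟩ := ihq (by omega) p hp
      obtain ⟨x, hx, hxp⟩ := T.exists_mem_moore_right (by omega) (T.exists_filler_aux hi y hy
        hp (by omega) (by omega) (by omega : m + 1 - q ≠ i) (by omega) (by omega) hw)
      refine ⟨w + x, fun l hl h ↦ ?_⟩
      rw [map_add]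
      by_cases hlq : l = m + 1 - q
      · rw [hlq, hxp, add_sub_cancel]
      · rw [hw l hl (by omega), T.mem_moore_succ.1 hx l hl (by omega), add_zero]
  obtain ⟨w, hw⟩ := key (m + 1 - i) (by omega) i le_rfl
  exact ⟨w, fun l hl h ↦ hw l hl (by omega)⟩

end SimplicialVectorSpace

/-! ### The simplicial tangent space at a base point -/

namespace KanTruncated

section Tangent

variable (X : SimplicialObject Mfd.{u}) (x : X.obj (op ⦋0⦌))

/-- The degenerate simplex at a point of the base. -/
def basePoint (k : SimplexCategory) : X.obj (op k) := Mfd.Hom.toFun (baseInclusion X k) x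

theorem map_basePoint {k l : SimplexCategory} (a : k ⟶ l) :
    Mfd.Hom.toFun (X.map a.op) (basePoint X x l) = basePoint X x k := by
  have h : baseInclusion X l ≫ X.map a.op = baseInclusion X k := by
    unfold baseInclusion
    rw [← X.map_comp, ← op_comp]
    congr 2
  exact congrFun (congrArg Mfd.Hom.toFun h) x

/-- The structure maps of the simplicial tangent space at a point of the base. -/
noncomputable def tangentMap {k l : SimplexCategory} (a : k ⟶ l) :
    EuclideanSpace ℝ (Fin (X.obj (op l)).dim) →L[ℝ] EuclideanSpace ℝ (Fin (X.obj (op k)).dim) :=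
  Mfd.deriv (X.map a.op) (basePoint X x l)

theorem tangentMap_id (k : SimplexCategory) :
    tangentMap X x (𝟙 k) = ContinuousLinearMap.id ℝ _ := by
  unfold tangentMap
  rw [op_id, X.map_id, Mfd.deriv_id]

theorem tangentMap_comp {k l m : SimplexCategory} (a : k ⟶ l) (b : l ⟶ m) :
    tangentMap X x (a ≫ b) = (tangentMap X x a).comp (tangentMap X x b) := by
  unfold tangentMap
  rw [op_comp, X.map_comp, Mfd.deriv_comp, map_basePoint]

theorem tangentMap_comp_apply {k l m : SimplexCategory} (a : k ⟶ l) (b : l ⟶ m)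
    (v : EuclideanSpace ℝ (Fin (X.obj (op m)).dim)) :
    tangentMap X x a (tangentMap X x b v) = tangentMap X x (a ≫ b) v := by
  rw [tangentMap_comp]; rfl

/-- The simplicial tangent space at a point of the base. -/
noncomputable def tangentSimplicial :
    SimplicialVectorSpace fun m : ℕ ↦ EuclideanSpace ℝ (Fin (X.obj (op ⦋m⦌)).dim) where
  d m i := if h : i < m + 2 then (tangentMap X x (SimplexCategory.δ ⟨i, h⟩)).toLinearMap else 0
  s m i := if h : i < m + 1 then (tangentMap X x (SimplexCategory.σ ⟨i, h⟩)).toLinearMap else 0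
  d_d {m i j} hij hj v := by
    rw [dif_pos (by omega), dif_pos (by omega), dif_pos (by omega), dif_pos (by omega)]
    change tangentMap X x _ (tangentMap X x _ v) = tangentMap X x _ (tangentMap X x _ v)
    rw [tangentMap_comp_apply, tangentMap_comp_apply]
    exact DFunLike.congr_fun (congrArg (tangentMap X x)
      (SimplexCategory.δ_comp_δ (i := (⟨i, by omega⟩ : Fin (m + 2))) (j := ⟨j, by omega⟩) hij)) v
  d_s_self {m i} hi v := by
    rw [dif_pos (by omega), dif_pos (by omega)]
    change tangentMap X x _ (tangentMap X x _ v) = v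
    rw [tangentMap_comp_apply]
    exact DFunLike.congr_fun ((congrArg (tangentMap X x)
      (SimplexCategory.δ_comp_σ_self (i := (⟨i, by omega⟩ : Fin (m + 1))))).trans
        (tangentMap_id X x _)) v
  d_s_succ {m i} hi v := by
    rw [dif_pos (by omega), dif_pos (by omega)]
    change tangentMap X x _ (tangentMap X x _ v) = v
    rw [tangentMap_comp_apply]
    exact DFunLike.congr_fun ((congrArg (tangentMap X x)
      (SimplexCategory.δ_comp_σ_succ (i := (⟨i, by omega⟩ : Fin (m + 1))))).trans
        (tangentMap_id X x _)) v
  d_s_of_le {m i j} hij hj v := by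
    rw [dif_pos (by omega), dif_pos (by omega), dif_pos (by omega), dif_pos (by omega)]
    change tangentMap X x _ (tangentMap X x _ v) = tangentMap X x _ (tangentMap X x _ v)
    rw [tangentMap_comp_apply, tangentMap_comp_apply]
    exact DFunLike.congr_fun (congrArg (tangentMap X x)
      (SimplexCategory.δ_comp_σ_of_le (i := (⟨i, by omega⟩ : Fin (m + 2)))
        (j := (⟨j, by omega⟩ : Fin (m + 1))) hij)) v
  d_s_of_lt {m i j} hij hi v := by
    rw [dif_pos (by omega), dif_pos (by omega), dif_pos (by omega), dif_pos (by omega)]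
    change tangentMap X x _ (tangentMap X x _ v) = tangentMap X x _ (tangentMap X x _ v)
    rw [tangentMap_comp_apply, tangentMap_comp_apply]
    exact DFunLike.congr_fun (congrArg (tangentMap X x)
      (SimplexCategory.δ_comp_σ_of_gt (i := (⟨i, by omega⟩ : Fin (m + 2)))
        (j := (⟨j, by omega⟩ : Fin (m + 1))) hij)) v

theorem tangentSimplicial_d {m i : ℕ} (h : i < m + 2)
    (v : EuclideanSpace ℝ (Fin (X.obj (op ⦋m + 1⦌)).dim)) :
    (tangentSimplicial X x).d m i v = tangentMap X x (SimplexCategory.δ ⟨i, h⟩) v := by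
  simp only [tangentSimplicial, dif_pos h]
  rfl

end Tangent

/-! ### Combinatorics of horns -/

section Horn

variable {n m : ℕ} {i : Fin (m + 2)}

/-- The operator `[k] → [m + 1]` underlying a simplex of a horn. -/
def hornHom (e : (hornWeight n (m + 1) i).Elements) : e.1.unop.obj ⟶ ⦋m + 1⦌ :=
  SSet.stdSimplex.objEquiv e.2.1

/-- The simplex of a horn given by an operator `[k] → [m + 1]` missing a vertex other than `i`. -/
def hornElement (k : SimplexCategory.Truncated n) (a : k.obj ⟶ ⦋m + 1⦌)
    (ha : ∃ j ≠ i, ∀ t, a.toOrderHom t ≠ j) : (hornWeight n (m + 1) i).Elements :=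
  ⟨op k, ⟨SSet.stdSimplex.objEquiv.symm a, by
    obtain ⟨j, hj, hj'⟩ := ha
    exact (SSet.mem_horn_iff_notMem_range _ _).2 ⟨j, hj, fun ⟨t, ht⟩ ↦ hj' t ht⟩⟩⟩

/-- An operator compatible with two simplices of a horn gives a morphism between them. -/
def hornElementsHom {e e' : (hornWeight n (m + 1) i).Elements}
    (a : e'.1.unop.obj ⟶ e.1.unop.obj) (ha : a ≫ hornHom e = hornHom e') : e ⟶ e' :=
  CategoryOfElements.homMk e e' (InducedCategory.homMk a).op
    (Subtype.ext (SSet.stdSimplex.objEquiv.injective ha))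

/-- Consequently a compatible family on a horn is determined by its codimension one faces. -/
theorem exists_factorization (e : (hornWeight n (m + 1) i).Elements) :
    ∃ (j : Fin (m + 2)) (_ : j ≠ i) (a : e.1.unop.obj ⟶ ⦋m⦌),
      a ≫ SimplexCategory.δ j = hornHom e := by
  obtain ⟨j, hj, hj'⟩ := (SSet.mem_horn_iff_notMem_range _ _).1 e.2.2
  exact ⟨j, hj, _, SimplexCategory.factor_δ_spec (hornHom e) j fun t ht ↦ hj' ⟨t, ht⟩⟩

/-- The codimension one faces of a horn. -/
def hornFace (hm : m ≤ n) (j : Fin (m + 2)) (hj : j ≠ i) : (hornWeight n (m + 1) i).Elements :=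
  hornElement ⟨⦋m⦌, hm⟩ (SimplexCategory.δ j) ⟨j, hj, fun t ↦ Fin.succAbove_ne j t⟩

instance : Finite (SimplexCategory.Truncated n) :=
  Finite.of_injective (β := Fin (n + 1)) (fun k ↦ ⟨k.obj.len, Nat.lt_succ_of_le k.property⟩) (by
    rintro ⟨k, hk⟩ ⟨l, hl⟩ h
    have : k = l := by
      ext; exact congrArg Fin.val h
    subst this
    rfl)

instance : Finite (hornWeight n (m + 1) i).Elements := by
  have : ∀ k, Finite ((hornWeight n (m + 1) i).obj k) := fun k ↦
    Finite.of_injective (β := (k.unop.obj ⟶ ⦋m + 1⦌))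
      (fun s ↦ SSet.stdSimplex.objEquiv s.1) fun s t h ↦
        Subtype.ext (SSet.stdSimplex.objEquiv.injective h)
  have : Finite (SimplexCategory.Truncated n)ᵒᵖ := Finite.of_equiv _ equivToOpposite
  exact inferInstanceAs (Finite (Σ k, (hornWeight n (m + 1) i).obj k))

instance (e e' : (hornWeight n (m + 1) i).Elements) : Finite (e ⟶ e') :=
  Finite.of_injective (β := (e'.1.unop.obj ⟶ e.1.unop.obj)) (fun f ↦ f.1.unop.hom)
    fun _ _ h ↦ CategoryOfElements.ext _ _ _
      (Quiver.Hom.unop_inj (InducedCategory.hom_ext h))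

end Horn

end KanTruncated

/-! ### Tubes of variable radius -/

/-- A neighbourhood of the constant families on a subspace `B` of `Q` contains all families of
points of a neighbourhood of `B` which are in a same fibre of retractions to `B`. -/
theorem exists_open_tube {B Q ι : Type*} [Fintype ι] [TopologicalSpace B] [TopologicalSpace Q]
    [TopologicalSpace.MetrizableSpace Q] {s : B → Q} (hs : Continuous s) {v : ι → Q → B}
    (hv : ∀ j, Continuous (v j)) (hvs : ∀ j b, v j (s b) = b) {V : Set (ι → Q)} (hV : IsOpen V)
    (hsV : ∀ b, (fun _ ↦ s b) ∈ V) :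
    ∃ W : Set Q, IsOpen W ∧ (∀ b, s b ∈ W) ∧
      ∀ z : ι → Q, (∀ j, z j ∈ W) → ∀ b, (∀ j, v j (z j) = b) → z ∈ V := by
  let _ : MetricSpace Q := TopologicalSpace.metrizableSpaceMetric Q
  let ε : B → ENNReal := fun b ↦ Metric.infEDist (fun _ ↦ s b : ι → Q) Vᶜ
  have hε : Continuous ε := Metric.continuous_infEDist.comp (continuous_pi fun _ ↦ hs)
  have hε₀ : ∀ b, 0 < ε b := fun b ↦ by
    rw [Metric.infEDist_pos_iff_notMem_closure, hV.isClosed_compl.closure_eq]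
    exact fun h ↦ h (hsV b)
  -- The radius at `b` is the distance from the constant family to the complement of `V`, so no
  -- compactness is needed. When all members retract to the same `b`, the bounds combine into one
  -- for the sup distance.
  refine ⟨{z | ∀ j, edist z (s (v j z)) < ε (v j z)}, ?_, fun b j ↦ ?_, fun z hz b hb ↦ ?_⟩
  · simp only [ofPred_forall]
    exact isOpen_iInter_of_finite fun j ↦ isOpen_lt
      (continuous_id.edist (hs.comp (hv j))) (hε.comp (hv j))
  · rw [hvs, edist_self]
    exact hε₀ b
  · by_contra hzV
    have h₁ : ε b ≤ edist (fun _ ↦ s b : ι → Q) z := Metric.infEDist_le_edist_of_mem hzV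
    have h₂ : edist z (fun _ ↦ s b : ι → Q) < ε b := by
      rw [edist_pi_def, Finset.sup_lt_iff (by exact hε₀ b)]
      intro j _
      have := hz j j
      rwa [hb j] at this
    rw [edist_comm] at h₁
    exact absurd h₂ (not_lt.2 h₁)

theorem Mfd.metrizableSpace (M : Mfd.{u}) : TopologicalSpace.MetrizableSpace M := by
  have : LocallyCompactSpace M :=
    ChartedSpace.locallyCompactSpace (EuclideanSpace ℝ (Fin M.dim)) M
  exact Manifold.metrizableSpace (𝓡 M.dim) M

/-! ### The horn projection at base points -/

namespace KanTruncated

section HornCone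

variable (X : SimplicialObject Mfd.{u}) {n m : ℕ} (i : Fin (m + 2))

/-- The diagram of manifolds whose limit is a horn space. -/
abbrev hornDiagram (n : ℕ) : (hornWeight n (m + 1) i).Elements ⥤ Mfd.{u} :=
  CategoryOfElements.π (hornWeight n (m + 1) i) ⋙ (SimplicialObject.truncation n).obj X

/-- The cone given by the structure maps of a simplicial manifold. -/
abbrev hornCone (hm : m + 1 ≤ n) : Cone (hornDiagram X i n) :=
  WeightedCone.mk (term ((SimplicialObject.truncation n).obj X) (m + 1) hm)
    (hornRestriction ((SimplicialObject.truncation n).obj X) (m + 1) hm i)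
    (hornRestriction_naturality ((SimplicialObject.truncation n).obj X) (m + 1) hm i)

variable (x : X.obj (op ⦋0⦌))

theorem coneFamily_hornCone_basePoint (hm : m + 1 ≤ n) (e : (hornWeight n (m + 1) i).Elements) :
    coneFamily (hornCone X i hm) (basePoint X x ⦋m + 1⦌) e = basePoint X x e.1.unop.obj :=
  map_basePoint X x (hornHom e)

theorem coneDeriv_hornCone (hm : m + 1 ≤ n) (e : (hornWeight n (m + 1) i).Elements) :
    coneDeriv (hornCone X i hm) (basePoint X x ⦋m + 1⦌) e = tangentMap X x (hornHom e) := rfl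

theorem deriv_hornDiagram_map (hm : m + 1 ≤ n) {e e' : (hornWeight n (m + 1) i).Elements}
    (f : e ⟶ e') :
    Mfd.deriv ((hornDiagram X i n).map f)
      (coneFamily (hornCone X i hm) (basePoint X x ⦋m + 1⦌) e) =
        tangentMap X x f.1.unop.hom := by
  rw [coneFamily_hornCone_basePoint]
  rfl

/-- The tangent map of the horn projection at a point of the base is surjective. -/
theorem exists_coneDeriv_hornCone_eq (hm : m + 1 ≤ n)
    (v : ∀ e, EuclideanSpace ℝ (Fin ((hornDiagram X i n).obj e).dim))
    (hv : ∀ ⦃e e'⦄ (f : e ⟶ e'), Mfd.deriv ((hornDiagram X i n).map f)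
      (coneFamily (hornCone X i hm) (basePoint X x ⦋m + 1⦌) e) (v e) = v e') :
    ∃ w, ∀ e, coneDeriv (hornCone X i hm) (basePoint X x ⦋m + 1⦌) e w = v e := by
  simp only [deriv_hornDiagram_map] at hv
  -- The value 0 at the missing face `i` and out of range is arbitrary: the filler problem never
  -- constrains it.
  let y : ℕ → EuclideanSpace ℝ (Fin (X.obj (op ⦋m⦌)).dim) := fun l ↦
    if h : ∃ h : l < m + 2, (⟨l, h⟩ : Fin (m + 2)) ≠ i then
      v (hornFace (by omega) ⟨l, h.1⟩ h.2) else 0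
  have hyv : ∀ (j : Fin (m + 2)) (hj : j ≠ i), y j = v (hornFace (by omega) j hj) :=
    fun j hj ↦ dif_pos (⟨j.2, hj⟩ : ∃ h : j.1 < m + 2, (⟨j.1, h⟩ : Fin (m + 2)) ≠ i)
  obtain ⟨w, hw⟩ := (tangentSimplicial X x).exists_filler (i := i) (by omega) y (by
    rintro m' rfl a b hab hb hai hbi
    have hai' : (⟨a, by omega⟩ : Fin (m' + 1 + 2)) ≠ i := fun h ↦ hai (congrArg Fin.val h)
    have hbi' : (⟨b + 1, by omega⟩ : Fin (m' + 1 + 2)) ≠ i := fun h ↦ hbi (congrArg Fin.val h)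
    change (tangentSimplicial X x).d m' a (y (b + 1)) = (tangentSimplicial X x).d m' b (y a)
    rw [tangentSimplicial_d X x (by omega), tangentSimplicial_d X x (by omega)]
    have hcomp := SimplexCategory.δ_comp_δ (i := (⟨a, by omega⟩ : Fin (m' + 2)))
      (j := ⟨b, by omega⟩) hab
    -- The common face of the faces `a` and `b + 1`; both compatibilities are compared through it.
    let e : (hornWeight n (m' + 1 + 1) i).Elements :=
      hornElement ⟨⦋m'⦌, by simp; omega⟩ (SimplexCategory.δ ⟨a, by omega⟩ ≫
        SimplexCategory.δ (⟨b + 1, by omega⟩ : Fin (m' + 1 + 2)))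
        ⟨_, hbi', fun t ↦ Fin.succAbove_ne _ _⟩
    have h₃ := hv (hornElementsHom (e := hornFace (by omega) _ hbi') (e' := e)
      (SimplexCategory.δ ⟨a, by omega⟩) rfl)
    have h₄ := hv (hornElementsHom (e := hornFace (by omega) _ hai') (e' := e)
      (SimplexCategory.δ ⟨b, by omega⟩) hcomp.symm)
    exact (congrArg (tangentMap X x _) (hyv _ hbi')).trans
      ((h₃.trans h₄.symm).trans (congrArg (tangentMap X x _) (hyv _ hai')).symm))
  refine ⟨w, fun e ↦ ?_⟩
  obtain ⟨j, hj, a, ha⟩ := exists_factorization e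
  have h₁ := hw j (by omega) (fun h ↦ hj (Fin.ext h))
  rw [tangentSimplicial_d X x j.2, hyv j hj] at h₁
  rw [coneDeriv_hornCone, ← ha, tangentMap_comp]
  have h₂ := hv (hornElementsHom (e := hornFace (by omega) j hj) (e' := e) a ha)
  rw [← h₂]
  exact congrArg (tangentMap X x a) h₁

/-- The dimension of a horn space. -/
def hornDim (X : SimplicialObject Mfd.{u}) (m : ℕ) : ℕ :=
  (X.obj (op ⦋m + 1⦌)).dim -
    SimplicialVectorSpace.mooreDim (fun k ↦ (X.obj (op ⦋k⦌)).dim) (m + 1) (m + 1)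

/-- The kernel is the Moore subspace for the first `i` and last `m + 1 - i` faces, of dimension
independent of `x` and `i`. This makes the dimension of the horn space constant. -/
theorem finrank_range_coneDeriv_hornCone (hm : m + 1 ≤ n) :
    Module.finrank ℝ (LinearMap.range (LinearMap.pi fun e ↦
      (coneDeriv (hornCone X i hm) (basePoint X x ⦋m + 1⦌) e).toLinearMap)) = hornDim X m := by
  let f : EuclideanSpace ℝ (Fin (X.obj (op ⦋m + 1⦌)).dim) →ₗ[ℝ]
      ∀ e, EuclideanSpace ℝ (Fin ((hornDiagram X i n).obj e).dim) := LinearMap.pi fun e ↦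
    (coneDeriv (hornCone X i hm) (basePoint X x ⦋m + 1⦌) e).toLinearMap
  change Module.finrank ℝ (LinearMap.range f) = hornDim X m
  have hker : LinearMap.ker f = (tangentSimplicial X x).moore (m + 1) i (m + 1 - i) := by
    ext w
    rw [SimplicialVectorSpace.mem_moore_succ, LinearMap.mem_ker]
    constructor
    · intro hw l hl h
      have hli : (⟨l, by omega⟩ : Fin (m + 2)) ≠ i := fun h' ↦ by
        have := congrArg Fin.val h'
        simp only at this
        omega
      rw [tangentSimplicial_d X x (by omega)]
      exact congrFun hw (hornFace (by omega) _ hli)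
    · intro hw
      funext e
      obtain ⟨j, hj, a, ha⟩ := exists_factorization e
      have h₁ := hw j (by omega) (by
        have : (j : ℕ) ≠ i := fun h ↦ hj (Fin.ext h)
        omega)
      rw [tangentSimplicial_d X x j.2] at h₁
      change tangentMap X x (hornHom e) w = 0
      rw [← ha, tangentMap_comp]
      exact (congrArg (tangentMap X x a) h₁).trans (map_zero _)
  have h₁ := LinearMap.finrank_range_add_finrank_ker f
  rw [hker, (tangentSimplicial X x).finrank_moore (D := fun k ↦ (X.obj (op ⦋k⦌)).dim)
    (fun k ↦ finrank_euclideanSpace_fin) (r := m + 1) (by omega) le_rfl,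
    finrank_euclideanSpace_fin] at h₁
  unfold hornDim
  omega

end HornCone

noncomputable instance {n m : ℕ} (i : Fin (m + 2)) : Fintype (hornWeight n (m + 1) i).Elements :=
  Fintype.ofFinite _

/-! ### Neighbourhoods satisfying the Kan condition -/

section Main

variable (X : SimplicialObject Mfd.{u}) {n m : ℕ} (i : Fin (m + 2))

/-- Every face `j ≠ i` contains the vertex `i`, so the faces of a compatible family retract to the
same point of the base and the tube argument applies. -/
theorem exists_open_horn (hm : m + 1 ≤ n) :
    ∃ W : TopologicalSpace.Opens (X.obj (op ⦋m⦌)), (∀ x, basePoint X x ⦋m⦌ ∈ W) ∧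
      ∀ y ∈ compatibleFamilies (hornDiagram X i n),
        (∀ j hj, y (hornFace (by omega) j hj) ∈ W) →
        ∃ χ : LocalChart (hornDiagram X i n).obj (compatibleFamilies (hornDiagram X i n))
          (hornDim X m), y ∈ χ.dom := by
  let ι := {j : Fin (m + 2) // j ≠ i}
  choose j hj a ha using fun e : (hornWeight n (m + 1) i).Elements ↦ exists_factorization e
  -- `Θ` rebuilds a family from its codimension one faces, returning every compatible family
  -- unchanged. It pulls the open set of charted families back to a power of X_m.
  let Θ : (ι → X.obj (op ⦋m⦌)) → ∀ e, (hornDiagram X i n).obj e := fun z e ↦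
    Mfd.Hom.toFun (X.map (a e).op) (z ⟨j e, hj e⟩)
  have hΘ : Continuous Θ := continuous_pi fun e ↦
    (Mfd.Hom.contMDiff (X.map (a e).op)).continuous.comp (continuous_apply _)
  let V : Set (∀ e, (hornDiagram X i n).obj e) :=
    ⋃ χ : LocalChart (hornDiagram X i n).obj (compatibleFamilies (hornDiagram X i n))
      (hornDim X m), χ.dom
  have hV : IsOpen V := isOpen_iUnion fun χ ↦ χ.isOpen_dom
  let vertex : ⦋0⦌ ⟶ ⦋m + 1⦌ := SimplexCategory.const _ _ i
  have hvertex : ∀ j : ι, SimplexCategory.factor_δ vertex j.1 ≫ SimplexCategory.δ j.1 = vertex :=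
    fun j ↦ SimplexCategory.factor_δ_spec vertex j.1 fun _ ↦ Ne.symm j.2
  have hbase : ∀ x, basePoint X x ⦋0⦌ = x := fun x ↦ by
    have h : baseInclusion X ⦋0⦌ = 𝟙 _ := by
      unfold baseInclusion
      rw [← X.map_id]
      exact congrArg (fun a : ⦋0⦌ ⟶ ⦋0⦌ ↦ X.map a.op) (Subsingleton.elim _ _)
    exact congrFun (congrArg Mfd.Hom.toFun h) x
  have := (X.obj (op ⦋m⦌)).metrizableSpace
  obtain ⟨W, hW, hWs, hWV⟩ := exists_open_tube (ι := ι)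
    (s := fun x ↦ basePoint X x ⦋m⦌) (Mfd.Hom.contMDiff (baseInclusion X ⦋m⦌)).continuous
    (v := fun j ↦ Mfd.Hom.toFun (X.map (SimplexCategory.factor_δ vertex j.1).op))
    (fun j ↦ (Mfd.Hom.contMDiff (X.map (SimplexCategory.factor_δ vertex j.1).op)).continuous)
    (fun j x ↦ (map_basePoint X x _).trans (hbase x)) (hV.preimage hΘ) (fun x ↦ by
      obtain ⟨χ, hχ, -⟩ := exists_localChart (hornCone X i hm) (basePoint X x ⦋m + 1⦌)
        (exists_coneDeriv_hornCone_eq X i x hm) (finrank_range_coneDeriv_hornCone X i x hm)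
      refine mem_iUnion.2 ⟨χ, ?_⟩
      convert! hχ using 1
      funext e
      exact (map_basePoint X x (a e)).trans (coneFamily_hornCone_basePoint X i x hm e).symm)
  refine ⟨⟨W, hW⟩, hWs, fun y hy hyW ↦ ?_⟩
  obtain ⟨j₀, hj₀⟩ := exists_ne i
  let e₀ : (hornWeight n (m + 1) i).Elements := hornElement ⟨⦋0⦌, Nat.zero_le n⟩ vertex
    ⟨j₀, hj₀, fun _ ↦ hj₀.symm⟩
  have h₁ := hWV (fun j ↦ y (hornFace (by omega) j.1 j.2)) (fun j ↦ hyW j.1 j.2) (y e₀)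
    fun j ↦ hy (hornElementsHom (e := hornFace (by omega) j.1 j.2) (e' := e₀)
      (SimplexCategory.factor_δ vertex j.1) (hvertex j))
  have h₂ : Θ (fun j ↦ y (hornFace (by omega) j.1 j.2)) = y := by
    funext e
    exact hy (hornElementsHom (e := hornFace (by omega) (j e) (hj e)) (e' := e) (a e) (ha e))
  have h₃ : Θ (fun j ↦ y (hornFace (by omega) j.1 j.2)) ∈ V := h₁
  rw [h₂] at h₃
  exact mem_iUnion.1 h₃

/-- The local chart at a base point also serves nearby points, where the derivative of the horn
projection stays surjective. -/
theorem exists_open_submersion (hm : m + 1 ≤ n) :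
    ∃ R : TopologicalSpace.Opens (X.obj (op ⦋m + 1⦌)), (∀ x, basePoint X x ⦋m + 1⦌ ∈ R) ∧
      ∀ y ∈ R, ∃ χ : LocalChart (hornDiagram X i n).obj
        (compatibleFamilies (hornDiagram X i n)) (hornDim X m),
        coneFamily (hornCone X i hm) y ∈ χ.dom ∧
        Function.Surjective (mfderiv (𝓡 (X.obj (op ⦋m + 1⦌)).dim) (𝓡 (hornDim X m))
          (fun y : X.obj (op ⦋m + 1⦌) ↦ χ.coord (coneFamily (hornCone X i hm) y)) y) := by
  let S : Set (X.obj (op ⦋m + 1⦌)) := {y | ∃ χ : LocalChart (hornDiagram X i n).obj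
        (compatibleFamilies (hornDiagram X i n)) (hornDim X m),
        coneFamily (hornCone X i hm) y ∈ χ.dom ∧
        Function.Surjective (mfderiv (𝓡 (X.obj (op ⦋m + 1⦌)).dim) (𝓡 (hornDim X m))
          (fun y : X.obj (op ⦋m + 1⦌) ↦ χ.coord (coneFamily (hornCone X i hm) y)) y)}
  refine ⟨⟨interior S, isOpen_interior⟩, fun x ↦ mem_interior_iff_mem_nhds.2 ?_,
    fun y hy ↦ interior_subset (s := S) hy⟩
  exact eventually_exists_localChart (hornCone X i hm) (basePoint X x ⦋m + 1⦌)
    (exists_coneDeriv_hornCone_eq X i x hm) (finrank_range_coneDeriv_hornCone X i x hm)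

/-- The Kan condition holds for sufficiently small neighbourhoods of the base. -/
theorem kanCondition_of_le (hm : m + 1 ≤ n) (U : Induced X n)
    (hW : ∀ y ∈ compatibleFamilies (hornDiagram X i n),
      (∀ j hj, y (hornFace ((Nat.le_succ m).trans hm) j hj) ∈
        U.nbhd (op ⟨⦋m⦌, (Nat.le_succ m).trans hm⟩)) →
        ∃ χ : LocalChart (hornDiagram X i n).obj (compatibleFamilies (hornDiagram X i n))
          (hornDim X m), y ∈ χ.dom)
    (hR : ∀ y : X.obj (op ⦋m + 1⦌), y ∈ U.nbhd (op ⟨⦋m + 1⦌, hm⟩) →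
      ∃ χ : LocalChart (hornDiagram X i n).obj
        (compatibleFamilies (hornDiagram X i n)) (hornDim X m),
        coneFamily (hornCone X i hm) y ∈ χ.dom ∧
        Function.Surjective (mfderiv (𝓡 (X.obj (op ⦋m + 1⦌)).dim) (𝓡 (hornDim X m))
          (fun y : X.obj (op ⦋m + 1⦌) ↦ χ.coord (coneFamily (hornCone X i hm) y)) y)) :
    KanCondition Mfd.submersions U.toTruncated (m + 1) hm i := by
  obtain ⟨L, hL, h⟩ := exists_isLimit_restrictFunctor (F := hornDiagram X i n)
    (U := fun e ↦ U.nbhd e.1) (hU := fun _ _ f ↦ U.map_mem f.1) (d := hornDim X m)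
    fun y hy hyU ↦ hW y hy fun j hj ↦ hyU (hornFace (by omega) j hj)
  refine ⟨L, hL, h (WeightedCone.mk (term U.toTruncated (m + 1) hm)
    (hornRestriction U.toTruncated (m + 1) hm i)
    (hornRestriction_naturality U.toTruncated (m + 1) hm i)) fun y ↦ ?_⟩
  obtain ⟨χ, hχ, hsurj⟩ := hR _ (Subtype.property y)
  refine ⟨χ, hχ, ?_⟩
  have hd : ContMDiffAt (𝓡 (X.obj (op ⦋m + 1⦌)).dim) (𝓡 (hornDim X m)) ∞
      (fun y : X.obj (op ⦋m + 1⦌) ↦ χ.coord (coneFamily (hornCone X i hm) y)) (Subtype.val y) :=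
    χ.contMDiffAt_coord (fun e ↦ Mfd.Hom.contMDiff (X.map (hornHom e).op) _) hχ
  exact surjective_mfderiv_comp_val (M := X.obj (op ⦋m + 1⦌))
    (U.nbhd (op ⟨⦋m + 1⦌, hm⟩)) y (hd.mdifferentiableAt (by simp)) hsurj

end Main

end KanTruncated

open KanTruncated in
theorem mainTheorem7 (X : CategoryTheory.SimplicialObject Mfd.{u}) (n : ℕ) :
    ∃ U : KanTruncated.Induced X n, KanTruncated.IsKanManifold U.toTruncated := by
  choose W hWb hW using fun (m : ℕ) (i : Fin (m + 2)) (hm : m + 1 ≤ n) ↦ exists_open_horn X i hm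
  choose R hRb hR using fun (m : ℕ) (i : Fin (m + 2)) (hm : m + 1 ≤ n) ↦
    exists_open_submersion X i hm
  let Y := (SimplicialObject.truncation n).obj X
  have hfin : ∀ k l : (SimplexCategory.Truncated n)ᵒᵖ, Finite (k ⟶ l) := fun k l ↦
    Finite.of_injective (β := (l.unop.obj ⟶ k.unop.obj)) (fun f ↦ f.unop.hom)
      fun _ _ h ↦ Quiver.Hom.unop_inj (InducedCategory.hom_ext h)
  -- Quantifying over all structure maps out of level `k` makes the family stable, because these are
  -- closed under composition. Finiteness of the hom-sets keeps it open, and identities recover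
  -- membership in `W` and `R`.
  let U : Induced X n :=
    { nbhd := fun k ↦
        ⟨{y | ∀ (m : Fin n) (i : Fin (m + 2)),
          (∀ g : k ⟶ op ⟨⦋m⦌, m.2.le⟩, Mfd.Hom.toFun (Y.map g) y ∈ W m i m.2) ∧
          ∀ g : k ⟶ op ⟨⦋m + 1⦌, m.2⟩, Mfd.Hom.toFun (Y.map g) y ∈ R m i m.2}, by
          simp only [ofPred_forall, ofPred_and]
          refine isOpen_iInter_of_finite fun m ↦ isOpen_iInter_of_finite fun i ↦ IsOpen.inter ?_ ?_
          · exact isOpen_iInter_of_finite fun g ↦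
              (W m i m.2).isOpen.preimage (Mfd.Hom.contMDiff (Y.map g)).continuous
          · exact isOpen_iInter_of_finite fun g ↦
              (R m i m.2).isOpen.preimage (Mfd.Hom.contMDiff (Y.map g)).continuous⟩
      base_mem := fun k x m i ↦ by
        refine ⟨fun g ↦ ?_, fun g ↦ ?_⟩
        · have h := map_basePoint X x g.unop.hom
          exact Eq.substr (p := fun y ↦ y ∈ W m i m.2) h (hWb m i m.2 x)
        · have h := map_basePoint X x g.unop.hom
          exact Eq.substr (p := fun y ↦ y ∈ R m i m.2) h (hRb m i m.2 x)
      map_mem := fun {k l} f y hy m i ↦ by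
        have h : ∀ {r} (g : l ⟶ r), Mfd.Hom.toFun (Y.map g) (Mfd.Hom.toFun (Y.map f) y) =
            Mfd.Hom.toFun (Y.map (f ≫ g)) y := fun g ↦ by
          rw [Y.map_comp]; rfl
        refine ⟨fun g ↦ ?_, fun g ↦ ?_⟩
        · exact Eq.substr (p := fun y ↦ y ∈ W m i m.2) (h g) ((hy m i).1 _)
        · exact Eq.substr (p := fun y ↦ y ∈ R m i m.2) (h g) ((hy m i).2 _) }
  refine ⟨U, fun m hm h1 i ↦ ?_⟩
  obtain ⟨m, rfl⟩ : ∃ m', m = m' + 1 := ⟨m - 1, by omega⟩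
  refine kanCondition_of_le X i hm U (fun y hy hyU ↦ hW m i hm y hy fun j hj ↦ ?_)
    fun y hy ↦ hR m i hm y ?_
  · have h := (hyU j hj ⟨m, hm⟩ i).1 (𝟙 _)
    rw [Y.map_id] at h
    exact h
  · have h := (hy ⟨m, hm⟩ i).2 (𝟙 _)
    rw [Y.map_id] at h
    exact h
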